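/- Let $n\ge 1$, $\mathbb{R}^{n+1}_+=\mathbb{R}^n\times(0,\infty)$ and $d\gamma(x)=e^{-|x|^2}\,dx$ on $\mathbb{R}^n$. Let $m(x)=1$ for $|x|\le 1$, $m(x)=1/|x|$ for $|x|\ge 1$, and $m_\beta=\beta m$. For $\alpha,\beta>0$, $x\in\mathbb{R}^n$ and $O\subset\mathbb{R}^n$ define the Gaussian cone and the Gaussian tent $$\Gamma^{\alpha,\beta}_\gamma(x)=\{(y,t)\in\mathbb{R}^{n+1}_+: |y-x|<\alpha t\wedge m_\beta(y)\},\qquad T^{\alpha,\beta}_\gamma(O)=\mathbb{R}^{n+1}_+\setminus\bigcup_{x\in O^c}\Gamma_\gamma^{\alpha,\beta}(x).$$ For $1\le q<\infty$ and (Lebesgue) measurable $f:\mathbb{R}^{n+1}_+\to\mathbb{R}$ put $$S_{q,\alpha,\beta}f(x)=\Big(\iint_{\Gamma_\gamma^{\alpha,\beta}(x)}\frac{|f(y,t)|^q}{\gamma(B(y,\alpha t\wedge m_\beta(y)))}\,d\gamma(y)\frac{dt}{t}\Big)^{1/q},$$ $$C_{q,\alpha,\beta}f(x)=\sup_{B=B(c_B,r_B):\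 x\in B(c_B,\alpha r_B\wedge m_\beta(c_B))}\Big(\frac1{\gamma(B)}\iint_{T^{\alpha,\beta}_\gamma(B)}|f(y,t)|^q\,d\gamma(y)\frac{dt}{t}\Big)^{1/q},$$ the supremum being over open balls with $r_B>0$, and for continuous $f$ put $S_{\infty,\alpha,\beta}f(x)=\sup_{\Gamma^{\alpha,\beta}_\gamma(x)}|f|$. All these take values in $[0,\infty]$. Let $\|f\|_{T^{p,q}_{\alpha,\beta}(\gamma)}\in[0,\infty]$ be $\|S_{q,\alpha,\beta}f\|_{L^p(\gamma)}$ if $p<\infty$ and $\|C_{q,\alpha,\beta}f\|_{L^\infty(\gamma)}$ if $p=\infty$, $q<\infty$. Let $T^{p,q}_{\alpha,\beta}(\gamma)$ be the set of $f$ (measurable if $q<\infty$, continuous if $q=\infty$) for which the corresponding function $S_{q,\alpha,\beta}f$, respectively $C_{q,\alpha,\beta}f$, is in $L^p(\gamma)$. **Theorem 3.5.** Let $\alpha,\beta,\delta,\lambda>0$, and let either (i) $1\le p,q<\infty$, or (ii) $1<p<\infty$, $q=\infty$, or (iii) $p=\infty$, $1<q<\infty$. Then there is a finite constant $C$ such that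 $$\|f\|_{T^{p,q}_{\alpha,\beta}(\gamma)}\le C\,\|f\|_{T^{p,q}_{\delta,\lambda}(\gamma)}\quad\text{and}\quad \|f\|_{T^{p,q}_{\delta,\lambda}(\gamma)}\le C\,\|f\|_{T^{p,q}_{\alpha,\beta}(\gamma)}$$ for every measurable $f:\mathbb{R}^{n+1}_+\to\mathbb{R}$ in cases (i) and (iii), and every continuous $f:\mathbb{R}^{n+1}_+\to\mathbb{R}$ in case (ii). In cases (ii) and (iii) the constant $C$ depends only on $n,\alpha,\beta,\delta,\lambda$; in case (i) it may depend on $p$ and $q$ as well. Consequently $T^{p,q}_{\alpha,\beta}(\gamma)=T^{p,q}_{\delta,\lambda}(\gamma)$ in all three cases, so that there is a single space $T^{p,q}(\gamma)$. -/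

import Mathlib

open MeasureTheory Set
open scoped ENNReal NNReal

noncomputable section

namespace GaussianTent

/-- The open upper half-space `ℝⁿ × (0, ∞)`; its points are written `(y, t)`. -/
abbrev HalfSpace (n : ℕ) : Type := EuclideanSpace ℝ (Fin n) × Set.Ioi (0 : ℝ)

/-- The (non-normalized) Gaussian measure `dγ(x) = exp (-|x|²) dx` on `ℝⁿ`. -/
def gaussian (n : ℕ) : Measure (EuclideanSpace ℝ (Fin n)) :=
  volume.withDensity fun x => ENNReal.ofReal (Real.exp (-‖x‖ ^ 2))

/-- The measure `dt / t` on `(0, ∞)`. -/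
def dtOverT : Measure (Set.Ioi (0 : ℝ)) :=
  (Measure.comap ((↑) : Set.Ioi (0 : ℝ) → ℝ) volume).withDensity
    fun t => ENNReal.ofReal ((t : ℝ)⁻¹)

/-- The measure `dγ(y) dt / t` on the upper half-space. -/
def halfSpaceMeasure (n : ℕ) : Measure (HalfSpace n) :=
  (gaussian n).prod dtOverT

variable {n : ℕ}

/-- The cutoff function `m(x) = 1` if `|x| ≤ 1` and `m(x) = 1 / |x|` otherwise. -/
def cutoff (x : EuclideanSpace ℝ (Fin n)) : ℝ :=
  if ‖x‖ ≤ 1 then 1 else 1 / ‖x‖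

/-- The radius `α t ∧ m_β(y)`, where `m_β = β m`. -/
def admRadius (α β : ℝ) (y : EuclideanSpace ℝ (Fin n)) (t : ℝ) : ℝ :=
  min (α * t) (β * cutoff y)

/-- The Gaussian cone with vertex `x`: all `(y, t)` with `|y - x| < α t ∧ m_β(y)`. -/
def cone (α β : ℝ) (x : EuclideanSpace ℝ (Fin n)) : Set (HalfSpace n) :=
  {z | ‖z.1 - x‖ < admRadius α β z.1 z.2}

/-- The Gaussian tent over `O`: the complement of the union of the cones with vertex outside `O`. -/
def tent (α β : ℝ) (O : Set (EuclideanSpace ℝ (Fin n))) : Set (HalfSpace n) :=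
  (⋃ x ∈ Oᶜ, cone α β x)ᶜ

/-- The area function `S_{q,α,β} f` for a finite exponent `q`, with values in `[0, ∞]`. -/
def areaFun (α β q : ℝ) (f : HalfSpace n → ℝ) (x : EuclideanSpace ℝ (Fin n)) : ℝ≥0∞ :=
  (∫⁻ z in cone α β x,
    ‖f z‖ₑ ^ q / gaussian n (Metric.ball z.1 (admRadius α β z.1 z.2))
      ∂(halfSpaceMeasure n)) ^ (1 / q)

/-- The non-tangential maximal function `S_{∞,α,β} f`, with values in `[0, ∞]`. -/
def areaFunTop (α β : ℝ) (f : HalfSpace n → ℝ) (x : EuclideanSpace ℝ (Fin n)) : ℝ≥0∞ :=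
  ⨆ z ∈ cone α β x, ‖f z‖ₑ

/-- The functional `C_{q,α,β} f`, with values in `[0, ∞]`: the supremum runs over all open balls
`B = B(c, r)`, `r > 0`, with `x ∈ B(c, α r ∧ m_β(c))`. -/
def carlesonFun (α β q : ℝ) (f : HalfSpace n → ℝ) (x : EuclideanSpace ℝ (Fin n)) : ℝ≥0∞ :=
  ⨆ (c : EuclideanSpace ℝ (Fin n)) (r : ℝ) (_ : 0 < r)
    (_ : x ∈ Metric.ball c (admRadius α β c r)),
    ((gaussian n (Metric.ball c r))⁻¹ *
      ∫⁻ z in tent α β (Metric.ball c r), ‖f z‖ₑ ^ q ∂(halfSpaceMeasure n)) ^ (1 / q)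

/-- The functional whose `L^p(γ)` norm is the norm of `T^{p,q}_{α,β}(γ)`: it is `C_{q,α,β} f` for
`p = ∞`, and `S_{q,α,β} f` for `p < ∞`. (The pair `p = q = ∞` is never used.) -/
def tentFunctional (α β : ℝ) (p q : ℝ≥0∞) (f : HalfSpace n → ℝ) :
    EuclideanSpace ℝ (Fin n) → ℝ≥0∞ :=
  if p = ∞ then carlesonFun α β q.toReal f
  else if q = ∞ then areaFunTop α β f
  else areaFun α β q.toReal f

/-- The norm of `f` in `T^{p,q}_{α,β}(γ)`, as an element of `[0, ∞]`. -/
def tentNorm (α β : ℝ) (p q : ℝ≥0∞) (f : HalfSpace n → ℝ) : ℝ≥0∞ :=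
  eLpNorm (tentFunctional α β p q f) p (gaussian n)

/-- The Gaussian tent space `T^{p,q}_{α,β}(γ)`: functions on the upper half-space, continuous if
`q = ∞` and Lebesgue measurable otherwise, whose functional lies in `L^p(γ)`.
The measure `dγ dt / t` has the null sets of the Lebesgue measure `dy dt`, so `AEMeasurable` with
respect to it is Lebesgue measurability. -/
def tentSpace (n : ℕ) (α β : ℝ) (p q : ℝ≥0∞) : Set (HalfSpace n → ℝ) :=
  {f | (if q = ∞ then Continuous f else AEMeasurable f (halfSpaceMeasure n)) ∧
    MemLp (tentFunctional α β p q f) p (gaussian n)}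

end GaussianTent

end

noncomputable section

namespace GaussianTent

/-! ### Layer-cake formulas and interpolation. -/

section LayerCake

/-! A point `(y, t)` enters the cones and tents only through its ball of radius `admRadius α β y t`.
For two parameter pairs these radii are comparable (`exists_admRadius_le_mul`), and on balls of
radius at most a multiple of `cutoff y` the Gaussian measure is doubling
(`exists_gaussian_ball_mul_le`). Vitali coverings by such balls therefore work as in Euclidean
space.

For `q = ∞` the superlevel sets of the maximal function are unions of admissible balls, and
enlarging the balls costs only a constant in measure. For `p = ∞` a tent is covered by tents, of the
other parameters, over enlargements of disjoint balls lying inside the original ball.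

For finite `p`, `q` the question is to compare the integrals of `coneIntegral ^ r` with `r = p / q`.
By Tonelli, pairing a cone integral with `g` averages `g` over the ball of each point, so a change
of parameters replaces `g` by its local maximal function (`exists_lintegral_coneIntegral_mul_le`).
Taking `g = 1` settles `r = 1`; duality and the strong maximal bound settle `r > 1`. For `r < 1`
duality is unavailable: one discards the points where a superlevel set has large local density,
estimates the remainder in `L¹` (`exists_setLIntegral_coneIntegral_le`), and integrates over levels.
-/

lemma lintegral_Ioi_indicator_lt_rpow {p : ℝ} (hp : 0 < p) (a : ℝ≥0∞) :
    ∫⁻ t in Ioi (0 : ℝ), {t : ℝ | ENNReal.ofReal t < a}.indicator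
      (fun t => ENNReal.ofReal (t ^ (p - 1))) t = ENNReal.ofReal p⁻¹ * a ^ p := by
  have key : ∀ b : ℝ, 0 ≤ b → ∫⁻ t in Ioc 0 b, ENNReal.ofReal (t ^ (p - 1)) =
      ENNReal.ofReal p⁻¹ * ENNReal.ofReal b ^ p := by
    intro b hb
    have hint : IntegrableOn (fun t : ℝ => t ^ (p - 1)) (Ioc 0 b) :=
      (intervalIntegrable_iff_integrableOn_Ioc_of_le hb).1
        (intervalIntegral.intervalIntegrable_rpow' (by linarith))
    rw [← ofReal_integral_eq_lintegral_ofReal hint, ← intervalIntegral.integral_of_le hb,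
      integral_rpow (Or.inl (by linarith)), ENNReal.ofReal_rpow_of_nonneg hb hp.le,
      ← ENNReal.ofReal_mul (by positivity)]
    · rw [sub_add_cancel, Real.zero_rpow hp.ne', sub_zero, div_eq_inv_mul]
    · filter_upwards [ae_restrict_mem measurableSet_Ioc] with t ht
      exact Real.rpow_nonneg ht.1.le _
  rcases eq_or_ne a ∞ with rfl | ha
  · rw [ENNReal.top_rpow_of_pos hp, ENNReal.mul_top (by simpa using hp)]
    simp only [ENNReal.ofReal_lt_top, ofPred_true, indicator_univ]
    refine ENNReal.eq_top_of_forall_nnreal_le fun r => ?_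
    -- The cut-off is chosen so that the integral up to it equals `r`.
    have h := key ((p * r) ^ p⁻¹) (by positivity)
    rw [ENNReal.ofReal_rpow_of_nonneg (by positivity) hp.le, Real.rpow_inv_rpow (by positivity)
      hp.ne', ← ENNReal.ofReal_mul (by positivity), inv_mul_cancel_left₀ hp.ne',
      ENNReal.ofReal_coe_nnreal] at h
    rw [← h]
    exact lintegral_mono_set Ioc_subset_Ioi_self
  · obtain ⟨b, rfl⟩ : ∃ b : ℝ≥0, (b : ℝ≥0∞) = a := ⟨a.toNNReal, ENNReal.coe_toNNReal ha⟩
    have h := key b b.2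
    rw [ENNReal.ofReal_coe_nnreal] at h
    rw [← h, setLIntegral_indicator (measurableSet_lt (by fun_prop) measurable_const)]
    refine (setLIntegral_congr ?_).trans (setLIntegral_congr Ioo_ae_eq_Ioc)
    refine Filter.Eventually.of_forall fun t => propext ?_
    change (ENNReal.ofReal t < (b : ℝ≥0∞) ∧ 0 < t) ↔ (0 < t ∧ t < b)
    refine ⟨fun ⟨h1, h2⟩ => ⟨h2, ?_⟩, fun ⟨h1, h2⟩ => ⟨?_, h1⟩⟩
    · rw [← ENNReal.ofReal_coe_nnreal] at h1
      exact (ENNReal.ofReal_lt_ofReal_iff_of_nonneg h2.le).1 h1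
    · rw [← ENNReal.ofReal_coe_nnreal]
      exact (ENNReal.ofReal_lt_ofReal_iff_of_nonneg h1.le).2 h2

/-- For `0 < a < ∞` this is an equality, convergence at infinity being exactly `r < 1`. At `a = ∞`
the left side vanishes, hence the inequality. -/
lemma mul_lintegral_Ioi_indicator_le_rpow {r : ℝ} (hr : r < 1) (a : ℝ≥0∞) :
    a * ∫⁻ t in Ioi (0 : ℝ), {t : ℝ | a ≤ ENNReal.ofReal t}.indicator
      (fun t => ENNReal.ofReal (t ^ (r - 2))) t ≤ ENNReal.ofReal (1 - r)⁻¹ * a ^ r := by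
  rcases eq_or_ne a ∞ with rfl | ha
  · simp
  rcases eq_or_ne a 0 with rfl | ha0
  · simp
  obtain ⟨b, rfl⟩ : ∃ b : ℝ≥0, (b : ℝ≥0∞) = a := ⟨a.toNNReal, ENNReal.coe_toNNReal ha⟩
  have hb : (0 : ℝ) < b := NNReal.coe_pos.2 (pos_iff_ne_zero.2 (by simpa using ha0))
  have hset : ∫⁻ t in Ioi (0 : ℝ), {t : ℝ | (b : ℝ≥0∞) ≤ ENNReal.ofReal t}.indicator
      (fun t => ENNReal.ofReal (t ^ (r - 2))) t =
      ∫⁻ t in Ioi (b : ℝ), ENNReal.ofReal (t ^ (r - 2)) := by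
    rw [setLIntegral_indicator (measurableSet_le measurable_const (by fun_prop))]
    refine (setLIntegral_congr ?_).trans (setLIntegral_congr Ioi_ae_eq_Ici).symm
    refine Filter.Eventually.of_forall fun t => propext ?_
    change ((b : ℝ≥0∞) ≤ ENNReal.ofReal t ∧ 0 < t) ↔ (b : ℝ) ≤ t
    rw [← ENNReal.ofReal_coe_nnreal]
    exact ⟨fun ⟨h1, h2⟩ => (ENNReal.ofReal_le_ofReal_iff h2.le).1 h1,
      fun h => ⟨ENNReal.ofReal_le_ofReal h, hb.trans_le h⟩⟩
  rw [hset, ← ofReal_integral_eq_lintegral_ofReal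
    (integrableOn_Ioi_rpow_of_lt (by linarith) hb), integral_Ioi_rpow_of_lt (by linarith) hb,
    ← ENNReal.ofReal_coe_nnreal, ENNReal.ofReal_rpow_of_pos hb, ← ENNReal.ofReal_mul hb.le,
    ← ENNReal.ofReal_mul (inv_nonneg.2 (by linarith))]
  · refine ENNReal.ofReal_le_ofReal (le_of_eq ?_)
    have h1 : r - 2 + 1 = r - 1 := by ring
    have h2 : (1 - r) ≠ 0 := by linarith
    have h3 : (r - 1) ≠ 0 := by linarith
    rw [h1, Real.rpow_sub_one hb.ne']
    field_simp
    ring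
  · filter_upwards [ae_restrict_mem measurableSet_Ioi] with t ht
    exact Real.rpow_nonneg (hb.trans ht).le _

variable {X : Type*} [MeasurableSpace X] {μ : Measure X} [SFinite μ]

/-- Tonelli on the region `S`: sections in `t` produce powers of a function, sections in `x` produce
integrals over its level sets. -/
lemma lintegral_mul_lintegral_indicator {S : Set (X × ℝ)} (hS : MeasurableSet S) {w : X → ℝ≥0∞}
    (hw : Measurable w) {k : ℝ → ℝ≥0∞} (hk : Measurable k) :
    ∫⁻ x, w x * (∫⁻ t in Ioi (0 : ℝ), {t | (x, t) ∈ S}.indicator k t) ∂μ =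
      ∫⁻ t in Ioi (0 : ℝ), k t * ∫⁻ x in {x | (x, t) ∈ S}, w x ∂μ := by
  have hsec : ∀ t, MeasurableSet {x | (x, t) ∈ S} := fun t => measurable_prodMk_right hS
  have hmeas : Measurable (Function.uncurry fun x t => w x * {t | (x, t) ∈ S}.indicator k t) := by
    have : (Function.uncurry fun x t => w x * {t | (x, t) ∈ S}.indicator k t) =
        S.indicator fun p => w p.1 * k p.2 := by
      ext ⟨x, t⟩
      by_cases h : (x, t) ∈ S <;> simp [h]
    rw [this]
    exact ((hw.comp measurable_fst).mul (hk.comp measurable_snd)).indicator hS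
  calc _ = ∫⁻ x, (∫⁻ t in Ioi (0 : ℝ), w x * {t | (x, t) ∈ S}.indicator k t) ∂μ :=
        lintegral_congr fun x =>
          (lintegral_const_mul _ (hk.indicator (measurable_prodMk_left hS))).symm
    _ = ∫⁻ t in Ioi (0 : ℝ), ∫⁻ x, w x * {t | (x, t) ∈ S}.indicator k t ∂μ :=
        lintegral_lintegral_swap hmeas.aemeasurable
    _ = _ := lintegral_congr fun t => by
        rw [← lintegral_const_mul _ hw, ← lintegral_indicator (hsec t)]
        refine lintegral_congr fun x => ?_
        by_cases h : (x, t) ∈ S <;> simp [h, mul_comm]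

/-- The weight `t ^ (p - 1)` is split as `t ^ (p - 2) * t` so that the weak-type quantity `t * μ {t
< G}` appears. -/
lemma lintegral_rpow_eq_layercake {G : X → ℝ≥0∞} (hG : Measurable G) {p : ℝ} (hp : 0 < p) :
    ∫⁻ x, G x ^ p ∂μ = ENNReal.ofReal p * ∫⁻ t in Ioi (0 : ℝ),
      ENNReal.ofReal (t ^ (p - 2)) * (ENNReal.ofReal t * μ {x | ENNReal.ofReal t < G x}) := by
  have h := lintegral_mul_lintegral_indicator (μ := μ)
    (S := {q : X × ℝ | ENNReal.ofReal q.2 < G q.1})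
    (measurableSet_lt (by fun_prop) (hG.comp measurable_fst)) (w := fun _ => 1) measurable_const
    (k := fun t => ENNReal.ofReal (t ^ (p - 1))) (by fun_prop)
  simp only [mem_ofPred_eq, lintegral_Ioi_indicator_lt_rpow hp, one_mul, lintegral_const,
    Measure.restrict_apply_univ] at h
  rw [lintegral_const_mul _ (hG.pow_const p)] at h
  calc _ = ENNReal.ofReal p * (ENNReal.ofReal p⁻¹ * ∫⁻ x, G x ^ p ∂μ) := by
        rw [← mul_assoc, ← ENNReal.ofReal_mul hp.le, mul_inv_cancel₀ hp.ne', ENNReal.ofReal_one,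
          one_mul]
    _ = _ := by
        rw [h]
        congr 1
        refine setLIntegral_congr_fun measurableSet_Ioi fun t (ht : 0 < t) => ?_
        rw [← mul_assoc, ← ENNReal.ofReal_mul (Real.rpow_nonneg ht.le _)]
        congr 2
        rw [← Real.rpow_add_one ht.ne']
        ring_nf

lemma measurable_ofReal_mul_meas_lt {g : X → ℝ≥0∞} (hg : Measurable g) :
    Measurable fun t => ENNReal.ofReal t * μ {x | ENNReal.ofReal t < g x} :=
  (by fun_prop : Measurable ENNReal.ofReal).mul (measurable_measure_prodMk_right
    (s := {q : X × ℝ | ENNReal.ofReal q.2 < g q.1})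
    (measurableSet_lt (by fun_prop) (hg.comp measurable_fst)))

lemma lintegral_rpow_le_of_layer_le {G : X → ℝ≥0∞} (hG : Measurable G) {p : ℝ} (hp : 0 < p)
    {C : ℝ≥0∞} {Φ : ℝ → ℝ≥0∞}
    (h : ∀ t : ℝ, 0 < t → ENNReal.ofReal t * μ {x | ENNReal.ofReal t < G x} ≤ C * Φ t)
    (hΦ : Measurable Φ) :
    ∫⁻ x, G x ^ p ∂μ ≤ C * (ENNReal.ofReal p *
      ∫⁻ t in Ioi (0 : ℝ), ENNReal.ofReal (t ^ (p - 2)) * Φ t) := by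
  have hm : Measurable fun t : ℝ => ENNReal.ofReal (t ^ (p - 2)) * Φ t := by fun_prop
  rw [lintegral_rpow_eq_layercake hG hp, mul_left_comm, ← lintegral_const_mul _ hm]
  refine mul_le_mul_right ?_ _
  refine setLIntegral_mono' measurableSet_Ioi fun t ht => ?_
  rw [mul_left_comm C]
  exact mul_le_mul_right (h t ht) _

lemma lintegral_rpow_le_of_meas_lt_le {G g : X → ℝ≥0∞} (hG : Measurable G) (hg : Measurable g)
    {p : ℝ} (hp : 0 < p) {C : ℝ≥0∞}
    (h : ∀ t : ℝ, μ {x | ENNReal.ofReal t < G x} ≤ C * μ {x | ENNReal.ofReal t < g x}) :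
    ∫⁻ x, G x ^ p ∂μ ≤ C * ∫⁻ x, g x ^ p ∂μ := by
  rw [lintegral_rpow_eq_layercake hg hp]
  refine lintegral_rpow_le_of_layer_le hG hp (fun t _ => ?_) ?_
  · rw [mul_left_comm]
    gcongr
    exact h t
  · exact measurable_ofReal_mul_meas_lt hg

lemma measurable_setLIntegral_section {S : Set (X × ℝ)} (hS : MeasurableSet S) {w : X → ℝ≥0∞}
    (hw : Measurable w) : Measurable fun t => ∫⁻ x in {x | (x, t) ∈ S}, w x ∂μ := by
  have h : ∀ t, ∫⁻ x in {x | (x, t) ∈ S}, w x ∂μ =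
      ∫⁻ x, S.indicator (fun q : X × ℝ => w q.1) (x, t) ∂μ := fun t => by
    have hsec : MeasurableSet {x | (x, t) ∈ S} := measurable_prodMk_right hS
    rw [← lintegral_indicator hsec]
    rfl
  simp_rw [h]
  exact ((hw.comp measurable_fst).indicator hS).lintegral_prod_left'

/-- Marcinkiewicz interpolation between weak type `(1, 1)` and a bound on `L^∞`. -/
lemma lintegral_rpow_le_of_weak {G g : X → ℝ≥0∞} (hG : Measurable G) (hg : Measurable g)
    {s : ℝ} (hs : 1 < s) {C : ℝ≥0∞}
    (h : ∀ t : ℝ, 0 < t → ENNReal.ofReal t * μ {x | ENNReal.ofReal t < G x} ≤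
      C * ∫⁻ x in {x | ENNReal.ofReal t < 2 * g x}, g x ∂μ) :
    ∫⁻ x, G x ^ s ∂μ ≤
      C * (ENNReal.ofReal (s / (s - 1)) * 2 ^ (s - 1)) * ∫⁻ x, g x ^ s ∂μ := by
  have hS : MeasurableSet {q : X × ℝ | ENNReal.ofReal q.2 < 2 * g q.1} :=
    measurableSet_lt (by fun_prop) ((hg.comp measurable_fst).const_mul 2)
  refine (lintegral_rpow_le_of_layer_le hG (by linarith) h
    (measurable_setLIntegral_section hS hg)).trans_eq ?_
  have hswap := lintegral_mul_lintegral_indicator (μ := μ) hS hg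
    (k := fun t => ENNReal.ofReal (t ^ (s - 2))) (by fun_prop)
  simp only [mem_ofPred_eq] at hswap
  have hs2 : s - 2 = s - 1 - 1 := by ring
  have hs1 : 0 < s - 1 := by linarith
  rw [← hswap, mul_assoc C, hs2]
  congr 1
  simp_rw [lintegral_Ioi_indicator_lt_rpow hs1]
  have hpt : ∀ x, g x * (ENNReal.ofReal (s - 1)⁻¹ * (2 * g x) ^ (s - 1)) =
      ENNReal.ofReal (s - 1)⁻¹ * 2 ^ (s - 1) * g x ^ s := fun x => by
    have hx : g x ^ s = g x * g x ^ (s - 1) := by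
      nth_rewrite 2 [← ENNReal.rpow_one (g x)]
      rw [← ENNReal.rpow_add_of_nonneg _ _ zero_le_one hs1.le, add_sub_cancel]
    rw [ENNReal.mul_rpow_of_nonneg _ _ hs1.le, hx]
    ring
  simp_rw [hpt]
  rw [lintegral_const_mul _ (hg.pow_const s), div_eq_mul_inv, ENNReal.ofReal_mul (by linarith)]
  ring

/-- The counterpart of Marcinkiewicz below exponent one. The first term reassembles to `∫ g ^ r`;
the second, by Tonelli, contains the integral of `t ^ (r - 2)` over `t ≥ g x`, which contributes `(1
- r)⁻¹`. -/
lemma lintegral_rpow_le_of_good {G g : X → ℝ≥0∞} (hG : Measurable G) (hg : Measurable g)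
    {r : ℝ} (hr0 : 0 < r) (hr : r < 1) {C : ℝ≥0∞}
    (h : ∀ t : ℝ, 0 < t → ENNReal.ofReal t * μ {x | ENNReal.ofReal t < G x} ≤
      C * (ENNReal.ofReal t * μ {x | ENNReal.ofReal t < g x} +
        ∫⁻ x in {x | g x ≤ ENNReal.ofReal t}, g x ∂μ)) :
    ∫⁻ x, G x ^ r ∂μ ≤ C * (1 + ENNReal.ofReal (r * (1 - r)⁻¹)) * ∫⁻ x, g x ^ r ∂μ := by
  have hS : MeasurableSet {q : X × ℝ | g q.1 ≤ ENNReal.ofReal q.2} :=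
    measurableSet_le (hg.comp measurable_fst) (by fun_prop)
  have hm : Measurable fun t => ENNReal.ofReal t * μ {x | ENNReal.ofReal t < g x} :=
    measurable_ofReal_mul_meas_lt hg
  refine (lintegral_rpow_le_of_layer_le hG hr0 h
    (hm.add (measurable_setLIntegral_section hS hg))).trans ?_
  have hswap := lintegral_mul_lintegral_indicator (μ := μ) hS hg
    (k := fun t => ENNReal.ofReal (t ^ (r - 2))) (by fun_prop)
  simp only [mem_ofPred_eq] at hswap
  have hadd : ∀ t, ENNReal.ofReal (t ^ (r - 2)) *
      (ENNReal.ofReal t * μ {x | ENNReal.ofReal t < g x} +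
        ∫⁻ x in {x | g x ≤ ENNReal.ofReal t}, g x ∂μ) =
      ENNReal.ofReal (t ^ (r - 2)) * (ENNReal.ofReal t * μ {x | ENNReal.ofReal t < g x}) +
        ENNReal.ofReal (t ^ (r - 2)) * ∫⁻ x in {x | g x ≤ ENNReal.ofReal t}, g x ∂μ :=
    fun t => mul_add _ _ _
  have hm' : Measurable fun t : ℝ => ENNReal.ofReal (t ^ (r - 2)) *
      (ENNReal.ofReal t * μ {x | ENNReal.ofReal t < g x}) := by fun_prop
  simp_rw [hadd]
  rw [lintegral_add_left hm', mul_add, ← lintegral_rpow_eq_layercake hg hr0, ← hswap,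
    mul_assoc, add_mul, one_mul]
  gcongr C * (_ + ?_)
  rw [ENNReal.ofReal_mul hr0.le, mul_assoc, ← lintegral_const_mul _ (hg.pow_const r)]
  exact mul_le_mul_right (lintegral_mono fun x => mul_lintegral_Ioi_indicator_le_rpow hr _) _

end LayerCake

/-! ### Admissible radii, cones and tents. -/

variable {n : ℕ}

lemma cutoff_pos (y : EuclideanSpace ℝ (Fin n)) : 0 < cutoff y := by
  unfold cutoff
  split_ifs with h
  · exact one_pos
  · exact one_div_pos.2 (by linarith)

lemma cutoff_le_one (y : EuclideanSpace ℝ (Fin n)) : cutoff y ≤ 1 := by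
  unfold cutoff
  split_ifs with h
  · exact le_rfl
  · exact (div_le_one (by linarith)).2 (by linarith)

lemma cutoff_mul_norm_le_one (y : EuclideanSpace ℝ (Fin n)) : cutoff y * ‖y‖ ≤ 1 := by
  unfold cutoff
  split_ifs with h
  · simpa using h
  · rw [one_div, inv_mul_cancel₀ (by linarith)]

lemma measurable_cutoff : Measurable (cutoff : EuclideanSpace ℝ (Fin n) → ℝ) :=
  Measurable.ite (measurableSet_le measurable_norm measurable_const) measurable_const
    (measurable_const.div measurable_norm)

lemma admRadius_pos {α β : ℝ} (hα : 0 < α) (hβ : 0 < β) (y : EuclideanSpace ℝ (Fin n)) {t : ℝ}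
    (ht : 0 < t) : 0 < admRadius α β y t :=
  lt_min (mul_pos hα ht) (mul_pos hβ (cutoff_pos y))

lemma admRadius_le (α β : ℝ) (y : EuclideanSpace ℝ (Fin n)) (t : ℝ) :
    admRadius α β y t ≤ β * cutoff y := min_le_right _ _

lemma admRadius_le_mul {α β δ lam K : ℝ} (h₁ : δ ≤ K * α) (h₂ : lam ≤ K * β) (hK : 0 ≤ K)
    (y : EuclideanSpace ℝ (Fin n)) {t : ℝ} (ht : 0 < t) :
    admRadius δ lam y t ≤ K * admRadius α β y t := by
  unfold admRadius
  rw [mul_min_of_nonneg _ _ hK, ← mul_assoc, ← mul_assoc]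
  exact min_le_min (mul_le_mul_of_nonneg_right h₁ ht.le)
    (mul_le_mul_of_nonneg_right h₂ (cutoff_pos y).le)

lemma exists_admRadius_le_mul {α β : ℝ} (hα : 0 < α) (hβ : 0 < β) (δ lam : ℝ) :
    ∃ K : ℝ, 1 ≤ K ∧ ∀ (y : EuclideanSpace ℝ (Fin n)) (t : ℝ), 0 < t →
      admRadius δ lam y t ≤ K * admRadius α β y t := by
  refine ⟨max 1 (max (δ / α) (lam / β)), le_max_left _ _, fun y t ht =>
    admRadius_le_mul ?_ ?_ (zero_le_one.trans (le_max_left _ _)) y ht⟩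
  · exact (div_le_iff₀ hα).1 ((le_max_left _ _).trans (le_max_right _ _))
  · exact (div_le_iff₀ hβ).1 ((le_max_right _ _).trans (le_max_right _ _))

lemma measurable_admRadius (α β : ℝ) :
    Measurable fun z : HalfSpace n => admRadius α β z.1 z.2 :=
  ((measurable_subtype_coe.comp measurable_snd).const_mul α).min
    ((measurable_cutoff.comp measurable_fst).const_mul β)

/-- The radius depends on the point of the half-space and not on the vertex, so cones are encoded by
one ball per point. -/
lemma mem_cone_iff {α β : ℝ} {x : EuclideanSpace ℝ (Fin n)} {z : HalfSpace n} :
    z ∈ cone α β x ↔ x ∈ Metric.ball z.1 (admRadius α β z.1 z.2) := by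
  rw [Metric.mem_ball, dist_comm, dist_eq_norm]
  rfl

lemma mem_tent_iff {α β : ℝ} {O : Set (EuclideanSpace ℝ (Fin n))} {z : HalfSpace n} :
    z ∈ tent α β O ↔ Metric.ball z.1 (admRadius α β z.1 z.2) ⊆ O := by
  simp only [tent, mem_compl_iff, mem_iUnion, mem_cone_iff, not_exists, subset_def]
  exact forall_congr' fun x => by tauto

/-! ### The Gaussian measure and its local doubling. -/

instance isFiniteMeasure_gaussian : IsFiniteMeasure (gaussian n) := by
  have h : Integrable fun v : EuclideanSpace ℝ (Fin n) => Real.exp (-‖v‖ ^ 2) := by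
    refine (GaussianFourier.integrable_cexp_neg_mul_sq_norm_add
      (V := EuclideanSpace ℝ (Fin n)) (b := 1) (by simp) 0 0).norm.congr ?_
    refine Filter.Eventually.of_forall fun v => ?_
    simp only [Complex.norm_exp]
    congr 1
    rw [zero_mul, add_zero, ← Complex.ofReal_pow, ← Complex.ofReal_one, ← Complex.ofReal_neg,
      ← Complex.ofReal_mul, Complex.ofReal_re]
    ring
  refine isFiniteMeasure_withDensity ?_
  exact h.lintegral_lt_top.ne

instance isOpenPosMeasure_gaussian : (gaussian n).IsOpenPosMeasure := by
  have : (volume : Measure (EuclideanSpace ℝ (Fin n))) ≪ gaussian n :=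
    withDensity_absolutelyContinuous'
      (by fun_prop) (Filter.Eventually.of_forall fun x => by simp [Real.exp_pos])
  exact this.isOpenPosMeasure

instance sFinite_dtOverT : SFinite dtOverT := by
  have : SFinite (Measure.comap ((↑) : Set.Ioi (0 : ℝ) → ℝ) volume) := by
    have : SigmaFinite (Measure.comap ((↑) : Set.Ioi (0 : ℝ) → ℝ) volume) :=
      SigmaFinite.of_map _ measurable_subtype_coe.aemeasurable
        (by rw [map_comap_subtype_coe measurableSet_Ioi]; infer_instance)
    infer_instance
  unfold dtOverT
  infer_instance

instance sFinite_halfSpaceMeasure : SFinite (halfSpaceMeasure n) := by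
  unfold halfSpaceMeasure
  infer_instance

lemma gaussian_ball_ne_zero (y : EuclideanSpace ℝ (Fin n)) {ρ : ℝ} (hρ : 0 < ρ) :
    gaussian n (Metric.ball y ρ) ≠ 0 :=
  (Metric.measure_ball_pos _ _ hρ).ne'

/-- The Gaussian measure is doubling on balls whose radius is at most a multiple of the cutoff
function at the centre. -/
lemma exists_gaussian_ball_mul_le (n : ℕ) (κ : ℝ) {K : ℝ} (hK : 1 ≤ K) :
    ∃ C : ℝ≥0, ∀ (y : EuclideanSpace ℝ (Fin n)) (ρ : ℝ), 0 < ρ → ρ ≤ κ * cutoff y →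
      gaussian n (Metric.ball y (K * ρ)) ≤ C * gaussian n (Metric.ball y ρ) := by
  -- `a` bounds the oscillation of `‖x‖ ^ 2` on the enlarged ball, by `cutoff y * ‖y‖ ≤ 1` and
  -- `cutoff y ≤ 1`. The density thus varies by a factor at most `exp (2 * a)`, and the volume by `K
  -- ^ n`.
  set a : ℝ := K * κ * (2 + K * κ) with ha
  refine ⟨Real.toNNReal (Real.exp (2 * a) * K ^ n), fun y ρ hρ hρκ => ?_⟩
  have hdiff : ∀ x ∈ Metric.ball y (K * ρ), |‖x‖ ^ 2 - ‖y‖ ^ 2| ≤ a := by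
    intro x hx
    rw [Metric.mem_ball, dist_eq_norm] at hx
    have h0 : 0 < cutoff y := cutoff_pos y
    have h1 := cutoff_le_one y
    have h2 := cutoff_mul_norm_le_one y
    have h3 : |‖x‖ - ‖y‖| ≤ K * κ * cutoff y :=
      ((abs_norm_sub_norm_le x y).trans hx.le).trans
        ((mul_le_mul_of_nonneg_left hρκ (by linarith)).trans_eq (by ring))
    have hκ : 0 ≤ K * κ := by
      by_contra! hneg
      have := (abs_nonneg _).trans h3
      nlinarith
    have h4 : |‖x‖ + ‖y‖| ≤ 2 * ‖y‖ + K * κ * cutoff y := by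
      rw [abs_of_nonneg (by positivity)]
      linarith [(abs_le.1 h3).2]
    calc |‖x‖ ^ 2 - ‖y‖ ^ 2| = |‖x‖ - ‖y‖| * |‖x‖ + ‖y‖| := by rw [← abs_mul]; ring_nf
      _ ≤ (K * κ * cutoff y) * (2 * ‖y‖ + K * κ * cutoff y) :=
        mul_le_mul h3 h4 (abs_nonneg _) (by positivity)
      _ = K * κ * (2 * (cutoff y * ‖y‖) + K * κ * (cutoff y * cutoff y)) := by ring
      _ ≤ a := by
        refine mul_le_mul_of_nonneg_left (add_le_add (by linarith) ?_) hκ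
        exact mul_le_of_le_one_right hκ (by nlinarith)
  have hupper : gaussian n (Metric.ball y (K * ρ)) ≤
      ENNReal.ofReal (Real.exp (-‖y‖ ^ 2 + a)) * volume (Metric.ball y (K * ρ)) := by
    rw [gaussian, withDensity_apply _ Metric.isOpen_ball.measurableSet]
    refine (setLIntegral_mono measurable_const fun x hx => ?_).trans_eq (setLIntegral_const _ _)
    refine ENNReal.ofReal_le_ofReal (Real.exp_le_exp.2 ?_)
    linarith [(abs_le.1 (hdiff x hx)).1]
  have hlower : ENNReal.ofReal (Real.exp (-‖y‖ ^ 2 - a)) * volume (Metric.ball y ρ) ≤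
      gaussian n (Metric.ball y ρ) := by
    rw [gaussian, withDensity_apply _ Metric.isOpen_ball.measurableSet, ← setLIntegral_const]
    refine setLIntegral_mono (by fun_prop) fun x hx => ?_
    refine ENNReal.ofReal_le_ofReal (Real.exp_le_exp.2 ?_)
    linarith [(abs_le.1 (hdiff x (Metric.ball_subset_ball (by nlinarith) hx))).2]
  have hvol : volume (Metric.ball y (K * ρ)) =
      ENNReal.ofReal (K ^ n) * volume (Metric.ball y ρ) := by
    rw [Measure.addHaar_ball_mul_of_pos _ _ (by linarith), Measure.addHaar_ball_center volume y,
      finrank_euclideanSpace_fin]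
  refine hupper.trans ?_
  rw [hvol]
  calc _ = ENNReal.ofReal (Real.exp (2 * a) * K ^ n) *
        (ENNReal.ofReal (Real.exp (-‖y‖ ^ 2 - a)) * volume (Metric.ball y ρ)) := by
        rw [← mul_assoc, ← mul_assoc, ← ENNReal.ofReal_mul (Real.exp_pos _).le,
          ← ENNReal.ofReal_mul (by positivity)]
        congr 2
        rw [mul_right_comm, ← Real.exp_add]
        ring_nf
    _ ≤ _ := mul_le_mul_right hlower _

/-! ### Vitali coverings by admissible balls. -/

/-- A Vitali covering lemma: the enlarged balls of a family are covered by further enlargements of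
the balls of a countable disjoint subfamily. -/
lemma exists_countable_disjoint_ball_cover {X ι : Type*} [PseudoMetricSpace X]
    [TopologicalSpace.SeparableSpace X] (y : ι → X) (ρ : ι → ℝ) {R K : ℝ} (hρ : ∀ i, 0 < ρ i)
    (hR : ∀ i, ρ i ≤ R) (hK : 1 ≤ K) :
    ∃ u : Set ι, u.Countable ∧ u.PairwiseDisjoint (fun i => Metric.ball (y i) (ρ i)) ∧
      ∀ i, ∃ j ∈ u, Metric.ball (y i) (K * ρ i) ⊆ Metric.ball (y j) (5 * K * ρ j) := by
  obtain ⟨u, -, hdisj, hcov⟩ := Vitali.exists_disjoint_subfamily_covering_enlargement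
    (fun i => Metric.ball (y i) (ρ i)) univ ρ 2 one_lt_two (fun i _ => (hρ i).le) R
    (fun i _ => hR i) (fun i _ => Metric.nonempty_ball.2 (hρ i))
  refine ⟨u, hdisj.countable_of_isOpen (fun _ _ => Metric.isOpen_ball)
    (fun i _ => Metric.nonempty_ball.2 (hρ i)), hdisj, fun i => ?_⟩
  obtain ⟨j, hj, ⟨w, hwi, hwj⟩, hle⟩ := hcov i (mem_univ i)
  -- With `ρ i ≤ 2 * ρ j` the centres are within `3 * ρ j`, and `2 * K + 3 ≤ 5 * K` since `1 ≤ K`.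
  refine ⟨j, hj, Metric.ball_subset_ball' ?_⟩
  rw [Metric.mem_ball] at hwi hwj
  have h1 : dist (y i) (y j) ≤ ρ i + ρ j :=
    (dist_triangle_left (y i) (y j) w).trans (add_le_add hwi.le hwj.le)
  have := hρ j
  nlinarith

/-- Superlevel sets are unions of the `U i`, hence open. This gives measurability of suprema over
uncountable families of balls. -/
lemma measurable_iSup_iSup_mem {X ι : Type*} [TopologicalSpace X] [MeasurableSpace X]
    [BorelSpace X] (U : ι → Set X) (hU : ∀ i, IsOpen (U i)) (a : ι → ℝ≥0∞) :
    Measurable fun x => ⨆ i, ⨆ (_ : x ∈ U i), a i := by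
  refine measurable_of_Ioi fun b => IsOpen.measurableSet ?_
  have : ((fun x => ⨆ i, ⨆ (_ : x ∈ U i), a i) ⁻¹' Ioi b) = ⋃ i, ⋃ (_ : b < a i), U i := by
    ext x
    simp only [mem_preimage, mem_Ioi, lt_iSup_iff, mem_iUnion, exists_prop]
    exact exists_congr fun i => and_comm
  rw [this]
  exact isOpen_iUnion fun i => isOpen_iUnion fun _ => hU i

/-- Vitali covering by admissible balls, together with the doubling of the selected balls. -/
lemma exists_admissible_ball_cover (n : ℕ) (κ : ℝ) {K : ℝ} (hK : 1 ≤ K) :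
    ∃ C : ℝ≥0, ∀ {ι : Type} (y : ι → EuclideanSpace ℝ (Fin n)) (ρ : ι → ℝ), (∀ i, 0 < ρ i) →
      (∀ i, ρ i ≤ κ * cutoff (y i)) →
      ∃ u : Set ι, u.Countable ∧ u.PairwiseDisjoint (fun i => Metric.ball (y i) (ρ i)) ∧
        (∀ i, ∃ j ∈ u, Metric.ball (y i) (K * ρ i) ⊆ Metric.ball (y j) (5 * K * ρ j)) ∧
        ∀ i, gaussian n (Metric.ball (y i) (5 * K * ρ i)) ≤
          C * gaussian n (Metric.ball (y i) (ρ i)) := by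
  obtain ⟨C, hC⟩ := exists_gaussian_ball_mul_le n κ (K := 5 * K) (by linarith)
  refine ⟨C, fun {ι} y ρ hρ hρκ => ?_⟩
  have hR : ∀ i, ρ i ≤ |κ| := fun i => (hρκ i).trans <|
    (mul_le_mul_of_nonneg_right (le_abs_self κ) (cutoff_pos _).le).trans
      (mul_le_of_le_one_right (abs_nonneg _) (cutoff_le_one _))
  obtain ⟨u, hu, hdisj, hcov⟩ := exists_countable_disjoint_ball_cover y ρ hρ hR hK
  exact ⟨u, hu, hdisj, hcov, fun i => hC _ _ (hρ i) (hρκ i)⟩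

/-- The further enlargements of a disjoint subfamily cover everything, and doubling brings each of
them back to its original ball. -/
lemma exists_gaussian_iUnion_ball_mul_le (n : ℕ) (κ : ℝ) {K : ℝ} (hK : 1 ≤ K) :
    ∃ C : ℝ≥0, ∀ {ι : Type} (y : ι → EuclideanSpace ℝ (Fin n)) (ρ : ι → ℝ), (∀ i, 0 < ρ i) →
      (∀ i, ρ i ≤ κ * cutoff (y i)) →
      gaussian n (⋃ i, Metric.ball (y i) (K * ρ i)) ≤
        C * gaussian n (⋃ i, Metric.ball (y i) (ρ i)) := by
  obtain ⟨C, hC⟩ := exists_admissible_ball_cover n κ hK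
  refine ⟨C, fun {ι} y ρ hρ hρκ => ?_⟩
  obtain ⟨u, hu, hdisj, hcov, hle⟩ := hC y ρ hρ hρκ
  calc _ ≤ gaussian n (⋃ j ∈ u, Metric.ball (y j) (5 * K * ρ j)) := by
        refine measure_mono (iUnion_subset fun i => ?_)
        obtain ⟨j, hj, hij⟩ := hcov i
        exact hij.trans (subset_biUnion_of_mem (u := fun j => Metric.ball (y j) (5 * K * ρ j)) hj)
    _ ≤ ∑' j : u, gaussian n (Metric.ball (y j) (5 * K * ρ j)) := measure_biUnion_le _ hu _
    _ ≤ ∑' j : u, C * gaussian n (Metric.ball (y j) (ρ j)) :=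
        ENNReal.tsum_le_tsum fun j => hle j
    _ = C * gaussian n (⋃ j ∈ u, Metric.ball (y j) (ρ j)) := by
        rw [ENNReal.tsum_mul_left,
          measure_biUnion hu hdisj fun _ _ => Metric.isOpen_ball.measurableSet]
    _ ≤ _ := by
        refine mul_le_mul_right (measure_mono ?_) _
        exact iUnion₂_subset fun j _ => subset_iUnion (fun j => Metric.ball (y j) (ρ j)) j

/-! ### The local maximal function. -/

/-- The balls `B(c, r)` with `0 < r ≤ κ m(c)`. -/
abbrev AdmissibleBall (n : ℕ) (κ : ℝ) : Type :=
  {b : EuclideanSpace ℝ (Fin n) × ℝ // 0 < b.2 ∧ b.2 ≤ κ * cutoff b.1}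

/-- The average of `g` over a ball with respect to the Gaussian measure. -/
def ballAverage (g : EuclideanSpace ℝ (Fin n) → ℝ≥0∞) (b : EuclideanSpace ℝ (Fin n) × ℝ) : ℝ≥0∞ :=
  (gaussian n (Metric.ball b.1 b.2))⁻¹ * ∫⁻ x in Metric.ball b.1 b.2, g x ∂(gaussian n)

/-- The uncentred maximal function over admissible balls. -/
def localMaximal (κ : ℝ) (g : EuclideanSpace ℝ (Fin n) → ℝ≥0∞) (x : EuclideanSpace ℝ (Fin n)) :
    ℝ≥0∞ :=
  ⨆ b : AdmissibleBall n κ, ⨆ (_ : x ∈ Metric.ball b.1.1 b.1.2), ballAverage g b.1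

lemma measurable_localMaximal (κ : ℝ) (g : EuclideanSpace ℝ (Fin n) → ℝ≥0∞) :
    Measurable (localMaximal κ g) :=
  measurable_iSup_iSup_mem _ (fun _ => Metric.isOpen_ball) _

lemma lt_localMaximal_iff {κ : ℝ} {g : EuclideanSpace ℝ (Fin n) → ℝ≥0∞}
    {x : EuclideanSpace ℝ (Fin n)} {a : ℝ≥0∞} :
    a < localMaximal κ g x ↔
      ∃ b : AdmissibleBall n κ, x ∈ Metric.ball b.1.1 b.1.2 ∧ a < ballAverage g b.1 := by
  simp only [localMaximal, lt_iSup_iff, exists_prop]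

lemma ballAverage_le_localMaximal {κ : ℝ} (g : EuclideanSpace ℝ (Fin n) → ℝ≥0∞)
    {y : EuclideanSpace ℝ (Fin n)} {ρ : ℝ} (hρ : 0 < ρ) (hρκ : ρ ≤ κ * cutoff y)
    {x : EuclideanSpace ℝ (Fin n)} (hx : x ∈ Metric.ball y ρ) :
    ballAverage g (y, ρ) ≤ localMaximal κ g x :=
  le_iSup₂_of_le (⟨(y, ρ), hρ, hρκ⟩ : AdmissibleBall n κ) hx le_rfl

lemma mul_gaussian_ball_le_of_lt_ballAverage {g : EuclideanSpace ℝ (Fin n) → ℝ≥0∞}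
    {b : EuclideanSpace ℝ (Fin n) × ℝ} (hb : 0 < b.2) {a : ℝ≥0∞} (h : a < ballAverage g b) :
    a * gaussian n (Metric.ball b.1 b.2) ≤ ∫⁻ x in Metric.ball b.1 b.2, g x ∂(gaussian n) := by
  rw [ballAverage, mul_comm, ← div_eq_mul_inv] at h
  exact (ENNReal.le_div_iff_mul_le (Or.inl (gaussian_ball_ne_zero _ hb))
    (Or.inl (measure_ne_top _ _))).1 h.le

/-- Vitali is applied to the balls on which the average of `g` exceeds `a`; on each selected ball
`a` times the measure is at most the integral of `g`, and these balls are disjoint. -/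
lemma exists_localMaximal_weak_le (n : ℕ) (κ : ℝ) :
    ∃ C : ℝ≥0, ∀ (g : EuclideanSpace ℝ (Fin n) → ℝ≥0∞) (a : ℝ≥0∞),
      a * gaussian n {x | a < localMaximal κ g x} ≤ C * ∫⁻ x, g x ∂(gaussian n) := by
  obtain ⟨C, hC⟩ := exists_admissible_ball_cover n κ le_rfl
  refine ⟨C, fun g a => ?_⟩
  let ι := {b : AdmissibleBall n κ // a < ballAverage g b.1}
  obtain ⟨u, hu, hdisj, hcov, hle⟩ := hC (ι := ι) (fun b => b.1.1.1) (fun b => b.1.1.2)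
    (fun b => b.1.2.1) (fun b => b.1.2.2)
  simp only [mul_one, one_mul] at hcov hle
  calc _ ≤ a * gaussian n (⋃ b ∈ u, Metric.ball b.1.1.1 (5 * b.1.1.2)) := by
        gcongr
        intro x hx
        obtain ⟨b, hxb, hb⟩ := lt_localMaximal_iff.1 hx
        obtain ⟨j, hj, hij⟩ := hcov ⟨b, hb⟩
        exact mem_biUnion hj (hij hxb)
    _ ≤ a * ∑' b : u, gaussian n (Metric.ball b.1.1.1.1 (5 * b.1.1.1.2)) := by
        gcongr
        exact measure_biUnion_le _ hu _
    _ ≤ C * ∑' b : u, ∫⁻ x in Metric.ball b.1.1.1.1 b.1.1.1.2, g x ∂(gaussian n) := by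
        rw [← ENNReal.tsum_mul_left, ← ENNReal.tsum_mul_left]
        refine ENNReal.tsum_le_tsum fun b => ?_
        refine (mul_le_mul_right (hle b.1) a).trans ?_
        rw [mul_left_comm]
        exact mul_le_mul_right (mul_gaussian_ball_le_of_lt_ballAverage b.1.1.2.1 b.1.2) _
    _ = C * ∫⁻ x in ⋃ b ∈ u, Metric.ball b.1.1.1 b.1.1.2, g x ∂(gaussian n) := by
        rw [lintegral_biUnion hu (fun _ _ => Metric.isOpen_ball.measurableSet) hdisj]
    _ ≤ _ := by
        gcongr
        exact Measure.restrict_le_self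

lemma exists_localMaximal_strong_le (n : ℕ) (κ : ℝ) {s : ℝ} (hs : 1 < s) :
    ∃ C : ℝ≥0, ∀ g : EuclideanSpace ℝ (Fin n) → ℝ≥0∞, Measurable g →
      ∫⁻ x, localMaximal κ g x ^ s ∂(gaussian n) ≤ C * ∫⁻ x, g x ^ s ∂(gaussian n) := by
  obtain ⟨C, hC⟩ := exists_localMaximal_weak_le n κ
  have hfin : (2 * C : ℝ≥0∞) * (ENNReal.ofReal (s / (s - 1)) * 2 ^ (s - 1)) ≠ ∞ := by
    have := ENNReal.rpow_ne_top_of_nonneg (y := s - 1) (by linarith) ENNReal.ofNat_ne_top (x := 2)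
    finiteness
  refine ⟨((2 * C : ℝ≥0∞) * (ENNReal.ofReal (s / (s - 1)) * 2 ^ (s - 1))).toNNReal,
    fun g hg => ?_⟩
  rw [ENNReal.coe_toNNReal hfin]
  refine lintegral_rpow_le_of_weak (measurable_localMaximal κ g) hg hs fun t ht => ?_
  set a := ENNReal.ofReal t with ha
  have hS : MeasurableSet {x | a < 2 * g x} := measurableSet_lt measurable_const (hg.const_mul 2)
  -- The discarded part of `g` is at most `a / 2`, so it adds at most `a / 2` to any average. A
  -- level `a` for `g` forces the level `a / 2` for `g'`, to which the weak bound applies.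
  set g' := {x | a < 2 * g x}.indicator g with hg'
  have hgg' : ∀ x, g x ≤ g' x + a / 2 := fun x => by
    by_cases h : a < 2 * g x
    · rw [hg', indicator_of_mem (by exact h)]
      exact le_self_add
    · refine le_add_left ((ENNReal.le_div_iff_mul_le (by simp) (by simp)).2 ?_)
      rw [mul_comm]
      exact not_lt.1 h
  have hsub : {x | a < localMaximal κ g x} ⊆ {x | a / 2 < localMaximal κ g' x} := by
    intro x hx
    obtain ⟨b, hxb, hb⟩ := lt_localMaximal_iff.1 hx
    refine lt_localMaximal_iff.2 ⟨b, hxb, ?_⟩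
    have h1 : ballAverage g b.1 ≤ ballAverage g' b.1 + a / 2 := by
      calc _ ≤ (gaussian n (Metric.ball b.1.1 b.1.2))⁻¹ *
            ∫⁻ x in Metric.ball b.1.1 b.1.2, (g' x + a / 2) ∂(gaussian n) :=
            mul_le_mul_right (lintegral_mono hgg') _
        _ = _ := by
            rw [lintegral_add_right _ measurable_const, setLIntegral_const, mul_add, ballAverage,
              mul_left_comm, ENNReal.inv_mul_cancel (gaussian_ball_ne_zero _ b.2.1)
                (measure_ne_top _ _), mul_one]
    have h2 : a / 2 + a / 2 < ballAverage g' b.1 + a / 2 := by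
      rw [ENNReal.add_halves]
      exact hb.trans_le h1
    exact lt_of_add_lt_add_right h2
  calc _ ≤ a * gaussian n {x | a / 2 < localMaximal κ g' x} := by gcongr
    _ = 2 * (a / 2 * gaussian n {x | a / 2 < localMaximal κ g' x}) := by
        rw [← mul_assoc, ENNReal.mul_div_cancel (by simp) (by simp)]
    _ ≤ 2 * (C * ∫⁻ x, g' x ∂(gaussian n)) := by
        exact mul_le_mul_right (hC _ _) _
    _ = _ := by rw [hg', lintegral_indicator hS, mul_assoc]

/-! ### The non-tangential maximal function (`q = ∞`). -/

lemma measurable_areaFunTop (α β : ℝ) (f : HalfSpace n → ℝ) : Measurable (areaFunTop α β f) := by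
  have h : areaFunTop α β f = fun x => ⨆ z : HalfSpace n,
      ⨆ (_ : x ∈ Metric.ball z.1 (admRadius α β z.1 z.2)), ‖f z‖ₑ := by
    ext x
    simp only [areaFunTop, mem_cone_iff]
  rw [h]
  exact measurable_iSup_iSup_mem _ (fun _ => Metric.isOpen_ball) _

lemma setOf_lt_areaFunTop (α β : ℝ) (f : HalfSpace n → ℝ) (a : ℝ≥0∞) :
    {x | a < areaFunTop α β f x} =
      ⋃ z : {z : HalfSpace n // a < ‖f z‖ₑ}, Metric.ball z.1.1 (admRadius α β z.1.1 z.1.2) := by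
  ext x
  simp only [areaFunTop, mem_cone_iff, mem_ofPred_eq, lt_iSup_iff, exists_prop, mem_iUnion,
    Subtype.exists]
  exact exists_congr fun z => and_comm

/-- Both superlevel sets are unions of balls about the same centres, those of the points where `f`
exceeds `a`, with comparable radii. The comparison holds level by level, so its constant involves no
exponent. -/
lemma exists_gaussian_lt_areaFunTop_le (n : ℕ) {α β : ℝ} (hα : 0 < α) (hβ : 0 < β) (δ lam : ℝ) :
    ∃ C : ℝ≥0, ∀ (f : HalfSpace n → ℝ) (a : ℝ≥0∞),
      gaussian n {x | a < areaFunTop δ lam f x} ≤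
        C * gaussian n {x | a < areaFunTop α β f x} := by
  obtain ⟨K, hK, hKle⟩ := exists_admRadius_le_mul (n := n) hα hβ δ lam
  obtain ⟨C, hC⟩ := exists_gaussian_iUnion_ball_mul_le n β hK
  refine ⟨C, fun f a => ?_⟩
  rw [setOf_lt_areaFunTop, setOf_lt_areaFunTop]
  refine le_trans (measure_mono (iUnion_mono fun z => ?_))
    (hC (ι := {z : HalfSpace n // a < ‖f z‖ₑ}) _ _
      (fun z => admRadius_pos hα hβ z.1.1 z.1.2.2) fun z => admRadius_le _ _ _ _)
  exact Metric.ball_subset_ball (hKle _ _ z.1.2.2)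

/-! ### The Carleson functional (`p = ∞`). -/

lemma measurable_carlesonFun (α β q : ℝ) (f : HalfSpace n → ℝ) :
    Measurable (carlesonFun α β q f) := by
  have h : carlesonFun α β q f = fun x => ⨆ b : {b : EuclideanSpace ℝ (Fin n) × ℝ // 0 < b.2},
      ⨆ (_ : x ∈ Metric.ball b.1.1 (admRadius α β b.1.1 b.1.2)),
        ((gaussian n (Metric.ball b.1.1 b.1.2))⁻¹ *
          ∫⁻ z in tent α β (Metric.ball b.1.1 b.1.2), ‖f z‖ₑ ^ q ∂(halfSpaceMeasure n)) ^
            (1 / q) := by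
    ext x
    rw [iSup_subtype, iSup_prod]
    rfl
  rw [h]
  exact measurable_iSup_iSup_mem _ (fun _ => Metric.isOpen_ball) _

/-- The admissible ball about `c` has positive measure, so it contains a point where the functional
is at most its essential supremum. Hence the essential supremum controls every tent, including those
over balls of large radius. -/
lemma lintegral_tent_le_essSup {α β q : ℝ} (hα : 0 < α) (hβ : 0 < β) (hq : 0 < q)
    (f : HalfSpace n → ℝ) (c : EuclideanSpace ℝ (Fin n)) {r : ℝ} (hr : 0 < r) :
    ∫⁻ z in tent α β (Metric.ball c r), ‖f z‖ₑ ^ q ∂(halfSpaceMeasure n) ≤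
      gaussian n (Metric.ball c r) * essSup (carlesonFun α β q f) (gaussian n) ^ q := by
  obtain ⟨x, hx, hle⟩ : ∃ x ∈ Metric.ball c (admRadius α β c r),
      carlesonFun α β q f x ≤ essSup (carlesonFun α β q f) (gaussian n) := by
    by_contra! hcon
    refine (gaussian_ball_ne_zero c (admRadius_pos hα hβ c hr)) (measure_mono_null ?_
      (ENNReal.ae_le_essSup (μ := gaussian n) (carlesonFun α β q f)))
    exact fun x hx => not_le.2 (hcon x hx)
  have h : ((gaussian n (Metric.ball c r))⁻¹ * ∫⁻ z in tent α β (Metric.ball c r),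
      ‖f z‖ₑ ^ q ∂(halfSpaceMeasure n)) ^ (1 / q) ≤
        essSup (carlesonFun α β q f) (gaussian n) := by
    refine le_trans (le_iSup₂_of_le c r ?_) hle
    rw [iSup_pos hr, iSup_pos hx]
  rw [one_div, ENNReal.rpow_inv_le_iff hq, mul_comm, ← div_eq_mul_inv] at h
  rw [mul_comm]
  exact (ENNReal.div_le_iff (gaussian_ball_ne_zero c hr) (measure_ne_top _ _)).1 h

/-- Keeps constants independent of the exponent once they are replaced by `max 1 C`. -/
lemma rpow_inv_le_self {C : ℝ≥0∞} (hC : 1 ≤ C) {q : ℝ} (hq : 1 ≤ q) : C ^ q⁻¹ ≤ C := by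
  simpa using ENNReal.rpow_le_rpow_of_exponent_le hC (inv_le_one_of_one_le₀ hq)

/-- Each point of the tent over `B` has its `(α, β)`-ball inside `B`. Its `(δ, lam)`-ball lies in an
enlargement of some ball of a disjoint subfamily, so the point belongs to the `(δ, lam)`-tent over
that enlargement. Summing the tent bounds and using doubling gives at most a constant times the
measure of `B`. -/
lemma exists_essSup_carlesonFun_le (n : ℕ) {α β δ lam : ℝ} (hα : 0 < α) (hβ : 0 < β)
    (hδ : 0 < δ) (hlam : 0 < lam) :
    ∃ C : ℝ≥0, ∀ (q : ℝ), 1 ≤ q → ∀ f : HalfSpace n → ℝ,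
      essSup (carlesonFun α β q f) (gaussian n) ≤
        C * essSup (carlesonFun δ lam q f) (gaussian n) := by
  obtain ⟨K, hK, hKle⟩ := exists_admRadius_le_mul (n := n) hα hβ δ lam
  obtain ⟨C, hC⟩ := exists_admissible_ball_cover n β hK
  refine ⟨max 1 C, fun q hq f => essSup_le_of_ae_le _ (Filter.Eventually.of_forall fun x => ?_)⟩
  have hq0 : 0 < q := by linarith
  set N := essSup (carlesonFun δ lam q f) (gaussian n) with hN
  refine iSup₂_le fun c r => iSup₂_le fun hr _ => ?_
  obtain ⟨u, hu, hdisj, hcov, hle⟩ := hC (ι := tent α β (Metric.ball c r)) (fun z => z.1.1)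
    (fun z => admRadius α β z.1.1 z.1.2) (fun z => admRadius_pos hα hβ z.1.1 z.1.2.2)
    (fun z => admRadius_le _ _ _ _)
  have : Countable u := hu
  have hint : ∫⁻ z in tent α β (Metric.ball c r), ‖f z‖ₑ ^ q ∂(halfSpaceMeasure n) ≤
      C * gaussian n (Metric.ball c r) * N ^ q := by
    calc _ ≤ ∫⁻ z in ⋃ j : u, tent δ lam
            (Metric.ball j.1.1.1 (5 * K * admRadius α β j.1.1.1 j.1.1.2)),
            ‖f z‖ₑ ^ q ∂(halfSpaceMeasure n) := by
          refine lintegral_mono_set fun z hz => ?_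
          obtain ⟨j, hj, hij⟩ := hcov ⟨z, hz⟩
          refine mem_iUnion.2 ⟨⟨j, hj⟩, mem_tent_iff.2 (Subset.trans ?_ hij)⟩
          exact Metric.ball_subset_ball (hKle _ _ z.2.2)
      _ ≤ ∑' j : u, ∫⁻ z in tent δ lam
            (Metric.ball j.1.1.1 (5 * K * admRadius α β j.1.1.1 j.1.1.2)),
            ‖f z‖ₑ ^ q ∂(halfSpaceMeasure n) := lintegral_iUnion_le _ _
      _ ≤ ∑' j : u, C * gaussian n (Metric.ball j.1.1.1 (admRadius α β j.1.1.1 j.1.1.2)) *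
            N ^ q := by
          refine ENNReal.tsum_le_tsum fun j => ?_
          refine (lintegral_tent_le_essSup hδ hlam hq0 f _ (mul_pos (by linarith)
            (admRadius_pos hα hβ j.1.1.1 j.1.1.2.2))).trans ?_
          gcongr
          exact hle j.1
      _ = C * gaussian n (⋃ j ∈ u, Metric.ball j.1.1 (admRadius α β j.1.1 j.1.2)) * N ^ q := by
          rw [ENNReal.tsum_mul_right, ENNReal.tsum_mul_left,
            measure_biUnion hu hdisj fun _ _ => Metric.isOpen_ball.measurableSet]
      _ ≤ _ := by
          gcongr
          exact iUnion₂_subset fun j _ => mem_tent_iff.1 j.2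
  calc _ ≤ ((gaussian n (Metric.ball c r))⁻¹ *
        (gaussian n (Metric.ball c r) * (C * N ^ q))) ^ (1 / q) := by
        gcongr
        exact hint.trans_eq (by ring)
    _ = (C * N ^ q) ^ q⁻¹ := by
        rw [← mul_assoc, ENNReal.inv_mul_cancel (gaussian_ball_ne_zero c hr) (measure_ne_top _ _),
          one_mul, one_div]
    _ ≤ (((max 1 C : ℝ≥0) : ℝ≥0∞) * N ^ q) ^ q⁻¹ := by
        gcongr
        exact le_max_right _ _
    _ ≤ _ := by
        rw [ENNReal.mul_rpow_of_nonneg _ _ (by positivity), ENNReal.rpow_rpow_inv hq0.ne']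
        exact mul_le_mul_left (rpow_inv_le_self (by exact_mod_cast le_max_left _ _) hq) _

/-! ### Cone integrals and their pairing with functions. -/

/-- The integral over the cone of a density averaged over admissible balls. -/
def coneIntegral (α β : ℝ) (h : HalfSpace n → ℝ≥0∞) (x : EuclideanSpace ℝ (Fin n)) : ℝ≥0∞ :=
  ∫⁻ z in cone α β x, h z / gaussian n (Metric.ball z.1 (admRadius α β z.1 z.2))
    ∂(halfSpaceMeasure n)

lemma areaFun_eq (α β q : ℝ) (f : HalfSpace n → ℝ) (x : EuclideanSpace ℝ (Fin n)) :
    areaFun α β q f x = coneIntegral α β (fun z => ‖f z‖ₑ ^ q) x ^ (1 / q) := rfl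

lemma coneIntegral_congr_ae (α β : ℝ) {h h' : HalfSpace n → ℝ≥0∞}
    (hh : h =ᵐ[halfSpaceMeasure n] h') : coneIntegral α β h = coneIntegral α β h' := by
  ext x
  refine lintegral_congr_ae (ae_restrict_of_ae ?_)
  filter_upwards [hh] with z hz
  rw [hz]

lemma measurableSet_cone_graph (α β : ℝ) :
    MeasurableSet {p : EuclideanSpace ℝ (Fin n) × HalfSpace n | p.2 ∈ cone α β p.1} :=
  measurableSet_lt ((measurable_fst.comp measurable_snd).sub measurable_fst).norm
    ((measurable_admRadius α β).comp measurable_snd)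

lemma measurableSet_cone (α β : ℝ) (x : EuclideanSpace ℝ (Fin n)) : MeasurableSet (cone α β x) :=
  measurable_prodMk_left (measurableSet_cone_graph α β)

lemma measurable_gaussian_ball_admRadius (α β : ℝ) :
    Measurable fun z : HalfSpace n =>
      gaussian n (Metric.ball z.1 (admRadius α β z.1 z.2)) := by
  have h := measurable_measure_prodMk_right (μ := gaussian n)
    (measurableSet_cone_graph (n := n) α β)
  convert h using 3 with z
  ext x
  exact mem_cone_iff.symm

lemma coneIntegral_eq_lintegral_indicator (α β : ℝ) (h : HalfSpace n → ℝ≥0∞)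
    (x : EuclideanSpace ℝ (Fin n)) :
    coneIntegral α β h x = ∫⁻ z,
      {p : EuclideanSpace ℝ (Fin n) × HalfSpace n | p.2 ∈ cone α β p.1}.indicator
        (fun p => h p.2 / gaussian n (Metric.ball p.2.1 (admRadius α β p.2.1 p.2.2))) (x, z)
        ∂(halfSpaceMeasure n) := by
  rw [coneIntegral, ← lintegral_indicator (measurableSet_cone α β x)]
  rfl

lemma measurable_indicator_cone_graph (α β : ℝ) {h : HalfSpace n → ℝ≥0∞} (hh : Measurable h) :
    Measurable ({p : EuclideanSpace ℝ (Fin n) × HalfSpace n | p.2 ∈ cone α β p.1}.indicator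
      (fun p => h p.2 / gaussian n (Metric.ball p.2.1 (admRadius α β p.2.1 p.2.2)))) :=
  ((hh.div (measurable_gaussian_ball_admRadius α β)).comp measurable_snd).indicator
    (measurableSet_cone_graph α β)

lemma measurable_coneIntegral (α β : ℝ) {h : HalfSpace n → ℝ≥0∞} (hh : Measurable h) :
    Measurable (coneIntegral α β h) := by
  simp_rw [funext (coneIntegral_eq_lintegral_indicator α β h)]
  exact (measurable_indicator_cone_graph α β hh).lintegral_prod_right'

/-- Tonelli: the vertices whose cones contain `z` fill the ball of `z`, and the normalisation in
`coneIntegral` turns the integral of `g` there into an average. -/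
lemma lintegral_coneIntegral_mul (α β : ℝ) {h : HalfSpace n → ℝ≥0∞} (hh : Measurable h)
    {g : EuclideanSpace ℝ (Fin n) → ℝ≥0∞} (hg : Measurable g) :
    ∫⁻ x, coneIntegral α β h x * g x ∂(gaussian n) =
      ∫⁻ z, h z * ballAverage g (z.1, admRadius α β z.1 z.2) ∂(halfSpaceMeasure n) := by
  have hm := measurable_indicator_cone_graph (n := n) α β hh
  calc _ = ∫⁻ x, ∫⁻ z,
        {p : EuclideanSpace ℝ (Fin n) × HalfSpace n | p.2 ∈ cone α β p.1}.indicator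
          (fun p => h p.2 / gaussian n (Metric.ball p.2.1 (admRadius α β p.2.1 p.2.2))) (x, z) *
          g x ∂(halfSpaceMeasure n) ∂(gaussian n) := by
        refine lintegral_congr fun x => ?_
        rw [coneIntegral_eq_lintegral_indicator]
        exact (lintegral_mul_const _ (hm.comp measurable_prodMk_left)).symm
    _ = _ := by
        rw [lintegral_lintegral_swap (hm.mul (hg.comp measurable_fst)).aemeasurable]
        refine lintegral_congr fun z => ?_
        rw [ballAverage, ← mul_assoc, ← div_eq_mul_inv,
          ← lintegral_indicator Metric.isOpen_ball.measurableSet,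
          ← lintegral_const_mul _ (hg.indicator Metric.isOpen_ball.measurableSet)]
        refine lintegral_congr fun x => ?_
        by_cases hx : z ∈ cone α β x
        · rw [indicator_of_mem (by exact hx), indicator_of_mem (mem_cone_iff.1 hx)]
        · rw [indicator_of_notMem (by exact hx), indicator_of_notMem (mt mem_cone_iff.2 hx),
            zero_mul, mul_zero]

lemma exists_common_admissible_ball (n : ℕ) {α β δ lam : ℝ} (hα : 0 < α) (hβ : 0 < β)
    (hδ : 0 < δ) (hlam : 0 < lam) :
    ∃ (κ : ℝ) (C : ℝ≥0), ∀ (y : EuclideanSpace ℝ (Fin n)) (t : ℝ), 0 < t →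
      ∃ R : ℝ, 0 < R ∧ R ≤ κ * cutoff y ∧ admRadius α β y t ≤ R ∧ admRadius δ lam y t ≤ R ∧
        gaussian n (Metric.ball y R) ≤ C * gaussian n (Metric.ball y (admRadius α β y t)) ∧
        gaussian n (Metric.ball y R) ≤ C * gaussian n (Metric.ball y (admRadius δ lam y t)) := by
  obtain ⟨K, hK, hKle⟩ := exists_admRadius_le_mul (n := n) hα hβ δ lam
  obtain ⟨L, hL, hLle⟩ := exists_admRadius_le_mul (n := n) hδ hlam α β
  obtain ⟨C, hC⟩ := exists_gaussian_ball_mul_le n β hK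
  -- The common radius is `K` times the `(α, β)`-radius, hence at most `K * L` times the `(δ,
  -- lam)`-radius.
  obtain ⟨D, hD⟩ := exists_gaussian_ball_mul_le n lam (K := K * L) (by nlinarith)
  refine ⟨K * β, max C D, fun y t ht => ⟨K * admRadius α β y t, ?_, ?_, ?_, hKle y t ht, ?_, ?_⟩⟩
  · exact mul_pos (by linarith) (admRadius_pos hα hβ y ht)
  · rw [mul_assoc]
    exact mul_le_mul_of_nonneg_left (admRadius_le _ _ _ _) (by linarith)
  · exact le_mul_of_one_le_left (admRadius_pos hα hβ y ht).le hK
  · refine (hC y _ (admRadius_pos hα hβ y ht) (admRadius_le _ _ _ _)).trans ?_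
    gcongr
    exact le_max_left _ _
  · refine le_trans (measure_mono (Metric.ball_subset_ball ?_))
      ((hD y _ (admRadius_pos hδ hlam y ht) (admRadius_le _ _ _ _)).trans ?_)
    · rw [mul_assoc]
      exact mul_le_mul_of_nonneg_left (hLle y t ht) (by linarith)
    · gcongr
      exact le_max_right _ _

/-- By doubling, the average is controlled by that over a common larger admissible ball. The latter
is a lower bound for the maximal function at every point of the `(α, β)`-ball, hence for its average
there. -/
lemma exists_ballAverage_le_localMaximal (n : ℕ) {α β δ lam : ℝ} (hα : 0 < α) (hβ : 0 < β)
    (hδ : 0 < δ) (hlam : 0 < lam) :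
    ∃ (κ : ℝ) (C : ℝ≥0), ∀ (g : EuclideanSpace ℝ (Fin n) → ℝ≥0∞)
      (y : EuclideanSpace ℝ (Fin n)) (t : ℝ), 0 < t →
      ballAverage g (y, admRadius δ lam y t) ≤
        C * ballAverage (localMaximal κ g) (y, admRadius α β y t) := by
  obtain ⟨κ, C, hC⟩ := exists_common_admissible_ball n hα hβ hδ hlam
  refine ⟨κ, C, fun g y t ht => ?_⟩
  obtain ⟨R, hR, hRκ, h1, h2, -, h4⟩ := hC y t ht
  have hne : ∀ {ρ : ℝ}, 0 < ρ → gaussian n (Metric.ball y ρ) ≠ 0 :=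
    fun hρ => gaussian_ball_ne_zero y hρ
  have hpα := admRadius_pos hα hβ y ht
  have hpδ := admRadius_pos hδ hlam y ht
  have hstep : ballAverage g (y, admRadius δ lam y t) ≤ C * ballAverage g (y, R) := by
    simp only [ballAverage]
    have hinv : (gaussian n (Metric.ball y (admRadius δ lam y t)))⁻¹ ≤
        C * (gaussian n (Metric.ball y R))⁻¹ := by
      rw [← div_eq_mul_inv, ENNReal.le_div_iff_mul_le (Or.inl (hne hR))
        (Or.inl (measure_ne_top _ _)), mul_comm, ← div_eq_mul_inv]
      exact (ENNReal.div_le_iff (hne hpδ) (measure_ne_top _ _)).2 h4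
    rw [← mul_assoc]
    exact mul_le_mul' hinv (lintegral_mono_set (Metric.ball_subset_ball h2))
  refine hstep.trans (mul_le_mul_right ?_ _)
  calc ballAverage g (y, R) = (gaussian n (Metric.ball y (admRadius α β y t)))⁻¹ *
        ∫⁻ _ in Metric.ball y (admRadius α β y t), ballAverage g (y, R) ∂(gaussian n) := by
        rw [setLIntegral_const, mul_left_comm,
          ENNReal.inv_mul_cancel (hne hpα) (measure_ne_top _ _), mul_one]
    _ ≤ _ := by
        refine mul_le_mul_right (setLIntegral_mono (measurable_localMaximal κ g) fun x hx => ?_) _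
        exact ballAverage_le_localMaximal g hR hRκ (Metric.ball_subset_ball h1 hx)

lemma exists_lintegral_coneIntegral_mul_le (n : ℕ) {α β δ lam : ℝ} (hα : 0 < α) (hβ : 0 < β)
    (hδ : 0 < δ) (hlam : 0 < lam) :
    ∃ (κ : ℝ) (C : ℝ≥0), ∀ h : HalfSpace n → ℝ≥0∞, Measurable h →
      ∀ g : EuclideanSpace ℝ (Fin n) → ℝ≥0∞, Measurable g →
      ∫⁻ x, coneIntegral δ lam h x * g x ∂(gaussian n) ≤
        C * ∫⁻ x, coneIntegral α β h x * localMaximal κ g x ∂(gaussian n) := by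
  obtain ⟨κ, C, hC⟩ := exists_ballAverage_le_localMaximal n hα hβ hδ hlam
  refine ⟨κ, C, fun h hh g hg => ?_⟩
  rw [lintegral_coneIntegral_mul δ lam hh hg,
    lintegral_coneIntegral_mul α β hh (measurable_localMaximal κ g),
    ← lintegral_const_mul' _ _ ENNReal.coe_ne_top]
  refine lintegral_mono fun z => ?_
  rw [mul_left_comm]
  exact mul_le_mul_right (hC g z.1 z.2 z.2.2) _

/-! ### Comparison of cone integrals for exponents at least one. -/

/-- The converse of Hölder's inequality on a finite measure space. -/
lemma lintegral_rpow_le_of_forall_lintegral_mul_le {X : Type*} [MeasurableSpace X]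
    {μ : Measure X} [IsFiniteMeasure μ] {F : X → ℝ≥0∞} (hF : Measurable F) {r s : ℝ}
    (hrs : r.HolderConjugate s) {A : ℝ≥0∞}
    (h : ∀ g : X → ℝ≥0∞, Measurable g → ∫⁻ x, F x * g x ∂μ ≤ A * (∫⁻ x, g x ^ s ∂μ) ^ (1 / s)) :
    ∫⁻ x, F x ^ r ∂μ ≤ A ^ r := by
  have hr0 := hrs.pos
  have hr1 : 0 ≤ r - 1 := hrs.sub_one_pos.le
  -- Truncation makes `I` finite, so that `I ^ (1 / s)` can be cancelled; monotone convergence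
  -- removes it.
  have htrunc : ∀ N : ℕ, ∫⁻ x, min (F x) N ^ r ∂μ ≤ A ^ r := by
    intro N
    set I := ∫⁻ x, min (F x) N ^ r ∂μ with hI
    have hpow : ∀ a : ℝ≥0∞, (a ^ (r - 1)) ^ s = a ^ r := fun a => by
      rw [← ENNReal.rpow_mul, hrs.sub_one_mul_conj]
    have hIle : I ≤ A * I ^ (1 / s) := by
      -- The extremal test function for Hölder, as `(r - 1) * s = r`.
      have := h (fun x => min (F x) N ^ (r - 1)) ((hF.min measurable_const).pow_const _)
      simp_rw [hpow] at this
      refine le_trans (lintegral_mono fun x => ?_) this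
      calc min (F x) N ^ r = min (F x) N ^ (1 : ℝ) * min (F x) N ^ (r - 1) := by
            rw [← ENNReal.rpow_add_of_nonneg _ _ zero_le_one hr1, add_sub_cancel]
        _ ≤ F x * min (F x) N ^ (r - 1) := by
            rw [ENNReal.rpow_one]
            exact mul_le_mul_left (min_le_left _ _) _
    have hItop : I ≠ ∞ := by
      refine ne_top_of_le_ne_top (b := (N : ℝ≥0∞) ^ r * μ univ) ?_ ?_
      · exact ENNReal.mul_ne_top
          (ENNReal.rpow_ne_top_of_nonneg hr0.le (ENNReal.natCast_ne_top N)) (measure_ne_top _ _)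
      · rw [← lintegral_const]
        exact lintegral_mono fun x => ENNReal.rpow_le_rpow (min_le_right _ _) hr0.le
    rcases eq_or_ne I 0 with h0 | h0
    · rw [h0]
      exact zero_le
    have hs0 := hrs.symm.pos
    have hsplit : I = I ^ (1 / r) * I ^ (1 / s) := by
      rw [← ENNReal.rpow_add _ _ h0 hItop, one_div, one_div, hrs.inv_add_inv_eq_one,
        ENNReal.rpow_one]
    have hle : I ^ (1 / r) ≤ A := by
      have h1 : I ^ (1 / s) ≠ 0 := by simp [h0, hItop]
      have h2 : I ^ (1 / s) ≠ ∞ := ENNReal.rpow_ne_top_of_nonneg (by positivity) hItop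
      refine (ENNReal.mul_le_mul_iff_left h1 h2).1 ?_
      rwa [← hsplit]
    rwa [one_div, ENNReal.rpow_inv_le_iff hr0] at hle
  refine le_of_tendsto' (lintegral_tendsto_of_tendsto_of_monotone
    (f := fun (N : ℕ) x => min (F x) N ^ r)
    (fun N => ((hF.min measurable_const).pow_const r).aemeasurable) ?_ ?_) htrunc
  · refine Filter.Eventually.of_forall fun x N M hNM => ?_
    exact ENNReal.rpow_le_rpow (min_le_min_left _ (by exact_mod_cast hNM)) hr0.le
  · refine Filter.Eventually.of_forall fun x => ?_
    have := (tendsto_const_nhds (x := F x)).min ENNReal.tendsto_nat_nhds_top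
    rw [min_top_right] at this
    exact this.ennrpow_const r

lemma exists_lintegral_coneIntegral_rpow_le_of_one_lt (n : ℕ) {α β δ lam : ℝ} (hα : 0 < α)
    (hβ : 0 < β) (hδ : 0 < δ) (hlam : 0 < lam) {r : ℝ} (hr : 1 < r) :
    ∃ C : ℝ≥0, ∀ h : HalfSpace n → ℝ≥0∞, Measurable h →
      ∫⁻ x, coneIntegral δ lam h x ^ r ∂(gaussian n) ≤
        C * ∫⁻ x, coneIntegral α β h x ^ r ∂(gaussian n) := by
  obtain ⟨κ, C, hC⟩ := exists_lintegral_coneIntegral_mul_le n hα hβ hδ hlam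
  have hrs := Real.HolderConjugate.conjExponent hr
  set s := r.conjExponent
  obtain ⟨D, hD⟩ := exists_localMaximal_strong_le n κ hrs.symm.lt
  have hs0 := hrs.symm.pos
  have hr0 := hrs.pos
  refine ⟨(C * D ^ (1 / s)) ^ r, fun h hh => ?_⟩
  refine (lintegral_rpow_le_of_forall_lintegral_mul_le (measurable_coneIntegral δ lam hh) hrs
    (A := C * D ^ (1 / s) * (∫⁻ x, coneIntegral α β h x ^ r ∂(gaussian n)) ^ (1 / r))
    fun g hg => ?_).trans_eq ?_
  · calc _ ≤ C * ∫⁻ x, coneIntegral α β h x * localMaximal κ g x ∂(gaussian n) := hC h hh g hg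
      _ ≤ C * ((∫⁻ x, coneIntegral α β h x ^ r ∂(gaussian n)) ^ (1 / r) *
          (∫⁻ x, localMaximal κ g x ^ s ∂(gaussian n)) ^ (1 / s)) :=
          mul_le_mul_right (ENNReal.lintegral_mul_le_Lp_mul_Lq _ hrs
            (measurable_coneIntegral α β hh).aemeasurable
            (measurable_localMaximal κ g).aemeasurable) _
      _ ≤ C * ((∫⁻ x, coneIntegral α β h x ^ r ∂(gaussian n)) ^ (1 / r) *
          (D * ∫⁻ x, g x ^ s ∂(gaussian n)) ^ (1 / s)) := by
          refine mul_le_mul_right (mul_le_mul_right (ENNReal.rpow_le_rpow (hD g hg) ?_) _) _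
          positivity
      _ = _ := by
          rw [ENNReal.mul_rpow_of_nonneg _ _ (by positivity)]
          ring
  · rw [ENNReal.mul_rpow_of_nonneg _ _ hr0.le, one_div r, ENNReal.rpow_inv_rpow hr0.ne',
      ENNReal.coe_rpow_of_nonneg _ hr0.le, ENNReal.coe_mul,
      ENNReal.coe_rpow_of_nonneg _ (by positivity)]

/-- The pairing estimate with `g = 1`, whose maximal function is at most one. -/
lemma exists_lintegral_coneIntegral_le (n : ℕ) {α β δ lam : ℝ} (hα : 0 < α) (hβ : 0 < β)
    (hδ : 0 < δ) (hlam : 0 < lam) :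
    ∃ C : ℝ≥0, ∀ h : HalfSpace n → ℝ≥0∞, Measurable h →
      ∫⁻ x, coneIntegral δ lam h x ∂(gaussian n) ≤
        C * ∫⁻ x, coneIntegral α β h x ∂(gaussian n) := by
  obtain ⟨κ, C, hC⟩ := exists_lintegral_coneIntegral_mul_le n hα hβ hδ hlam
  refine ⟨C, fun h hh => ?_⟩
  have hle := hC h hh (fun _ => 1) measurable_const
  simp only [mul_one] at hle
  refine hle.trans (mul_le_mul_right (lintegral_mono fun x => ?_) _)
  refine mul_le_of_le_one_right' (iSup₂_le fun b _ => ?_)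
  rw [ballAverage, setLIntegral_const, one_mul]
  exact ENNReal.inv_mul_le_one _

/-! ### Comparison of cone integrals for exponents below one. -/

/-- If the `(δ, lam)`-ball of `z` contains a point where `O` has low density at all admissible
scales, then at least half of the `(α, β)`-ball of `z` lies outside `O`. After Tonelli this compares
the two integrands at each `z`, which explains the factor `2`. -/
lemma exists_setLIntegral_coneIntegral_le (n : ℕ) {α β δ lam : ℝ} (hα : 0 < α) (hβ : 0 < β)
    (hδ : 0 < δ) (hlam : 0 < lam) :
    ∃ (κ : ℝ) (η : ℝ≥0), 0 < η ∧ ∀ h : HalfSpace n → ℝ≥0∞, Measurable h →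
      ∀ O : Set (EuclideanSpace ℝ (Fin n)), MeasurableSet O →
      ∫⁻ x in {x | localMaximal κ (O.indicator 1) x ≤ η}, coneIntegral δ lam h x ∂(gaussian n) ≤
        2 * ∫⁻ x in Oᶜ, coneIntegral α β h x ∂(gaussian n) := by
  obtain ⟨κ, C, hC⟩ := exists_common_admissible_ball n hα hβ hδ hlam
  -- Chosen so that `η * C ≤ 1 / 2`; the added `1` keeps `η` positive even if `C = 0`.
  refine ⟨κ, (2 * (C + 1))⁻¹, by positivity, fun h hh O hO => ?_⟩
  set η : ℝ≥0 := (2 * (C + 1))⁻¹ with hη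
  set Q := {x | localMaximal κ (O.indicator 1) x ≤ η} with hQdef
  have hQ : MeasurableSet Q := measurableSet_le (measurable_localMaximal κ _) measurable_const
  have hone : ∀ {S : Set (EuclideanSpace ℝ (Fin n))}, MeasurableSet S →
      Measurable (S.indicator (1 : EuclideanSpace ℝ (Fin n) → ℝ≥0∞)) :=
    fun hS => measurable_one.indicator hS
  have hmul : ∀ (a b : ℝ) {S : Set (EuclideanSpace ℝ (Fin n))}, MeasurableSet S →
      ∫⁻ x in S, coneIntegral a b h x ∂(gaussian n) =
        ∫⁻ x, coneIntegral a b h x * S.indicator 1 x ∂(gaussian n) := fun a b S hS => by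
    rw [← lintegral_indicator hS]
    refine lintegral_congr fun x => ?_
    by_cases hx : x ∈ S <;> simp [hx]
  have havg : ∀ {S : Set (EuclideanSpace ℝ (Fin n))}, MeasurableSet S →
      ∀ b : EuclideanSpace ℝ (Fin n) × ℝ, ballAverage (S.indicator 1) b =
        (gaussian n (Metric.ball b.1 b.2))⁻¹ * gaussian n (S ∩ Metric.ball b.1 b.2) := by
    intro S hS b
    rw [ballAverage, lintegral_indicator_one hS, Measure.restrict_apply hS]
  rw [hmul δ lam hQ, hmul α β hO.compl, lintegral_coneIntegral_mul δ lam hh (hone hQ),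
    lintegral_coneIntegral_mul α β hh (hone hO.compl),
    ← lintegral_const_mul' _ _ ENNReal.ofNat_ne_top]
  refine lintegral_mono fun z => ?_
  rw [mul_left_comm]
  refine mul_le_mul_right ?_ _
  obtain ⟨R, hR, hRκ, h1, h2, h3, -⟩ := hC z.1 z.2 z.2.2
  have hpα := admRadius_pos hα hβ z.1 z.2.2
  set B := Metric.ball z.1 (admRadius α β z.1 z.2) with hB
  have hB0 : gaussian n B ≠ 0 := gaussian_ball_ne_zero _ hpα
  have hBtop : gaussian n B ≠ ∞ := measure_ne_top _ _
  rcases (Q ∩ Metric.ball z.1 (admRadius δ lam z.1 z.2)).eq_empty_or_nonempty with hemp | hex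
  · rw [havg hQ, hemp, measure_empty, mul_zero]
    exact zero_le
  obtain ⟨x, hxQ, hxB⟩ := hex
  have hsmall : gaussian n (O ∩ B) ≤ gaussian n B / 2 := by
    have h5 := (ballAverage_le_localMaximal (O.indicator 1) hR hRκ
      (Metric.ball_subset_ball h2 hxB)).trans hxQ
    rw [havg hO, mul_comm, ← div_eq_mul_inv,
      ENNReal.div_le_iff (gaussian_ball_ne_zero _ hR) (measure_ne_top _ _)] at h5
    calc _ ≤ gaussian n (O ∩ Metric.ball z.1 R) :=
          measure_mono (inter_subset_inter_right _ (Metric.ball_subset_ball h1))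
      _ ≤ η * (C * gaussian n B) := h5.trans (mul_le_mul_right h3 _)
      _ = ((η * C : ℝ≥0) : ℝ≥0∞) * gaussian n B := by rw [ENNReal.coe_mul, mul_assoc]
      _ ≤ ((2⁻¹ : ℝ≥0) : ℝ≥0∞) * gaussian n B := by
          refine mul_le_mul_left (ENNReal.coe_le_coe.2 ?_) _
          rw [hη, mul_inv, mul_assoc]
          refine mul_le_of_le_one_right' ?_
          rw [inv_mul_le_iff₀ (by positivity), mul_one]
          exact le_self_add
      _ = gaussian n B / 2 := by
          rw [ENNReal.coe_inv two_ne_zero, mul_comm, div_eq_mul_inv, ENNReal.coe_ofNat]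
  have hlarge : gaussian n B / 2 ≤ gaussian n (Oᶜ ∩ B) := by
    have h6 : gaussian n B / 2 + gaussian n B / 2 ≤ gaussian n B / 2 + gaussian n (Oᶜ ∩ B) := by
      rw [ENNReal.add_halves]
      calc gaussian n B ≤ gaussian n (O ∩ B) + gaussian n (Oᶜ ∩ B) := by
            refine le_trans (measure_mono ?_) (measure_union_le _ _)
            rw [← union_inter_distrib_right, union_compl_self, univ_inter]
        _ ≤ _ := by gcongr
    exact (ENNReal.add_le_add_iff_left (ENNReal.div_ne_top hBtop two_ne_zero)).1 h6
  rw [havg hQ, havg hO.compl]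
  calc _ ≤ (1 : ℝ≥0∞) := (mul_le_mul_right (measure_mono inter_subset_right) _).trans
        (ENNReal.inv_mul_le_one _)
    _ = 2 * ((gaussian n B)⁻¹ * (gaussian n B / 2)) := by
        rw [mul_left_comm, ENNReal.mul_div_cancel two_ne_zero ENNReal.ofNat_ne_top,
          ENNReal.inv_mul_cancel hB0 hBtop]
    _ ≤ _ := mul_le_mul_right (mul_le_mul_right hlarge _) _

/-- At level `a`, take `O = {a < G}`. The weak bound for the indicator of `O` at height `η` makes
the bad set `Qᶜ` at most a multiple of `O`; on `Q`, Chebyshev and the `L¹` estimate bound the rest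
by the integral of `G` over `{G ≤ a}`. -/
lemma exists_lintegral_coneIntegral_rpow_le_of_lt_one (n : ℕ) {α β δ lam : ℝ} (hα : 0 < α)
    (hβ : 0 < β) (hδ : 0 < δ) (hlam : 0 < lam) {r : ℝ} (hr0 : 0 < r) (hr : r < 1) :
    ∃ C : ℝ≥0, ∀ h : HalfSpace n → ℝ≥0∞, Measurable h →
      ∫⁻ x, coneIntegral δ lam h x ^ r ∂(gaussian n) ≤
        C * ∫⁻ x, coneIntegral α β h x ^ r ∂(gaussian n) := by
  obtain ⟨κ, η, hη, hle⟩ := exists_setLIntegral_coneIntegral_le n hα hβ hδ hlam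
  obtain ⟨C, hC⟩ := exists_localMaximal_weak_le n κ
  refine ⟨max (η⁻¹ * C) 2 * (1 + (r * (1 - r)⁻¹).toNNReal), fun h hh => ?_⟩
  have hF := measurable_coneIntegral δ lam hh
  have hG := measurable_coneIntegral α β hh
  rw [ENNReal.coe_mul, ENNReal.coe_add, ENNReal.coe_one]
  refine lintegral_rpow_le_of_good hF hG hr0 hr fun t ht => ?_
  set F := coneIntegral δ lam h
  set G := coneIntegral α β h
  set a := ENNReal.ofReal t
  set O := {x | a < G x} with hO
  have hOm : MeasurableSet O := measurableSet_lt measurable_const hG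
  set Q := {x | localMaximal κ (O.indicator 1) x ≤ η} with hQ
  have hcompl : Oᶜ = {x | G x ≤ a} := by
    ext x
    simp [hO]
  have hQc : Qᶜ = {x | (η : ℝ≥0∞) < localMaximal κ (O.indicator 1) x} := by
    ext x
    simp [hQ]
  have hweak : gaussian n Qᶜ ≤ (η⁻¹ * C : ℝ≥0) * gaussian n O := by
    have h1 := hC (O.indicator 1) η
    rw [lintegral_indicator_one hOm, ← hQc] at h1
    rw [ENNReal.coe_mul, ENNReal.coe_inv hη.ne', mul_assoc]
    calc _ = (η : ℝ≥0∞)⁻¹ * (η * gaussian n Qᶜ) := by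
          rw [← mul_assoc, ENNReal.inv_mul_cancel (by simpa using hη.ne') ENNReal.coe_ne_top,
            one_mul]
      _ ≤ _ := mul_le_mul_right h1 _
  have hcheb : a * gaussian n ({x | a < F x} ∩ Q) ≤ ∫⁻ x in Q, F x ∂(gaussian n) := by
    have hm : MeasurableSet {x | a < F x} := measurableSet_lt measurable_const hF
    rw [← Measure.restrict_apply hm]
    refine le_trans ?_ (mul_meas_ge_le_lintegral hF a)
    exact mul_le_mul_right (measure_mono fun x (hx : a < F x) => hx.le) _
  calc a * gaussian n {x | a < F x} ≤
        a * (gaussian n Qᶜ + gaussian n ({x | a < F x} ∩ Q)) := by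
        refine mul_le_mul_right (le_trans (measure_mono fun x hx => ?_) (measure_union_le _ _)) _
        by_cases hxQ : x ∈ Q
        · exact Or.inr ⟨hx, hxQ⟩
        · exact Or.inl hxQ
    _ ≤ a * ((η⁻¹ * C : ℝ≥0) * gaussian n O) + 2 * ∫⁻ x in Oᶜ, G x ∂(gaussian n) := by
        rw [mul_add]
        exact add_le_add (mul_le_mul_right hweak _) (hcheb.trans (hle h hh O hOm))
    _ ≤ _ := by
        rw [mul_add, hcompl, mul_left_comm]
        refine add_le_add (mul_le_mul_left ?_ _) (mul_le_mul_left ?_ _)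
        · exact ENNReal.coe_le_coe.2 (le_max_left _ _)
        · exact ENNReal.coe_le_coe.2 (le_max_right _ _)

lemma exists_lintegral_coneIntegral_rpow_le (n : ℕ) {α β δ lam : ℝ} (hα : 0 < α)
    (hβ : 0 < β) (hδ : 0 < δ) (hlam : 0 < lam) {r : ℝ} (hr : 0 < r) :
    ∃ C : ℝ≥0, ∀ h : HalfSpace n → ℝ≥0∞, Measurable h →
      ∫⁻ x, coneIntegral δ lam h x ^ r ∂(gaussian n) ≤
        C * ∫⁻ x, coneIntegral α β h x ^ r ∂(gaussian n) := by
  rcases lt_trichotomy r 1 with h1 | rfl | h1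
  · exact exists_lintegral_coneIntegral_rpow_le_of_lt_one n hα hβ hδ hlam hr h1
  · simpa only [ENNReal.rpow_one] using exists_lintegral_coneIntegral_le n hα hβ hδ hlam
  · exact exists_lintegral_coneIntegral_rpow_le_of_one_lt n hα hβ hδ hlam h1

/-! ### From integrals to norms and spaces. -/

lemma eLpNorm_le_of_lintegral_rpow_le {X : Type*} [MeasurableSpace X] {μ : Measure X}
    {G g : X → ℝ≥0∞} {p : ℝ≥0∞} (hp : 1 ≤ p) (hp' : p ≠ ∞) {C : ℝ≥0}
    (h : ∫⁻ x, G x ^ p.toReal ∂μ ≤ C * ∫⁻ x, g x ^ p.toReal ∂μ) :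
    eLpNorm G p μ ≤ (max 1 C : ℝ≥0) * eLpNorm g p μ := by
  have hp0 : p ≠ 0 := (zero_lt_one.trans_le hp).ne'
  have hp1 : 1 ≤ p.toReal := by simpa using ENNReal.toReal_mono hp' hp
  rw [eLpNorm_eq_lintegral_rpow_enorm_toReal hp0 hp', eLpNorm_eq_lintegral_rpow_enorm_toReal hp0 hp']
  simp only [enorm_eq_self, one_div]
  calc _ ≤ (((max 1 C : ℝ≥0) : ℝ≥0∞) * ∫⁻ x, g x ^ p.toReal ∂μ) ^ p.toReal⁻¹ := by
        refine ENNReal.rpow_le_rpow (h.trans (mul_le_mul_left ?_ _)) (by positivity)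
        exact ENNReal.coe_le_coe.2 (le_max_right _ _)
    _ ≤ _ := by
        rw [ENNReal.mul_rpow_of_nonneg _ _ (by positivity)]
        exact mul_le_mul_left (rpow_inv_le_self (by exact_mod_cast le_max_left _ _) hp1) _

lemma measurable_areaFun (α β q : ℝ) {f : HalfSpace n → ℝ}
    (hf : AEMeasurable f (halfSpaceMeasure n)) : Measurable (areaFun α β q f) := by
  have hae : (fun z => ‖f z‖ₑ ^ q) =ᵐ[halfSpaceMeasure n] fun z => ‖hf.mk f z‖ₑ ^ q := by
    filter_upwards [hf.ae_eq_mk] with z hz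
    rw [← hz]
  rw [funext (areaFun_eq α β q f), coneIntegral_congr_ae α β hae]
  exact (measurable_coneIntegral α β (hf.measurable_mk.enorm.pow_const q)).pow_const _

lemma measurable_tentFunctional (α β : ℝ) (p q : ℝ≥0∞) {f : HalfSpace n → ℝ}
    (hf : q = ∞ ∨ AEMeasurable f (halfSpaceMeasure n)) :
    Measurable (tentFunctional α β p q f) := by
  unfold tentFunctional
  split_ifs with hp hq
  · exact measurable_carlesonFun _ _ _ _
  · exact measurable_areaFunTop _ _ _
  · exact measurable_areaFun _ _ _ (hf.resolve_left hq)

/-- The functions admitted to the tent space: continuous if `q = ∞`, Lebesgue measurable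
otherwise. -/
def IsTentAdmissible (q : ℝ≥0∞) (f : HalfSpace n → ℝ) : Prop :=
  if q = ∞ then Continuous f else AEMeasurable f (halfSpaceMeasure n)

lemma tentSpace_subset {α β δ lam : ℝ} {p q : ℝ≥0∞} {C : ℝ≥0}
    (h : ∀ f : HalfSpace n → ℝ, IsTentAdmissible q f →
      tentNorm α β p q f ≤ C * tentNorm δ lam p q f) :
    tentSpace n δ lam p q ⊆ tentSpace n α β p q := by
  rintro f ⟨hf, hmem⟩
  refine ⟨hf, (measurable_tentFunctional α β p q ?_).aestronglyMeasurable, ?_⟩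
  · by_cases hq : q = ∞
    · exact Or.inl hq
    · rw [if_neg hq] at hf
      exact Or.inr hf
  · exact (h f hf).trans_lt (ENNReal.mul_lt_top ENNReal.coe_lt_top hmem.2)

lemma tentSpace_eq {α β δ lam : ℝ} {p q : ℝ≥0∞} {C : ℝ≥0}
    (h : ∀ f : HalfSpace n → ℝ, IsTentAdmissible q f →
      tentNorm α β p q f ≤ C * tentNorm δ lam p q f ∧
        tentNorm δ lam p q f ≤ C * tentNorm α β p q f) :
    tentSpace n α β p q = tentSpace n δ lam p q :=
  (tentSpace_subset fun f hf => (h f hf).2).antisymm (tentSpace_subset fun f hf => (h f hf).1)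

/-- The `p`-th power of the norm is the integral of `coneIntegral ^ (p / q)` for the density `‖f‖ₑ ^
q`; a measurable representative of `f` gives the same cone integrals. -/
lemma exists_tentNorm_le (n : ℕ) {α β δ lam : ℝ} (hα : 0 < α) (hβ : 0 < β) (hδ : 0 < δ)
    (hlam : 0 < lam) {p q : ℝ≥0∞} (hp : 1 ≤ p) (hp' : p ≠ ∞) (hq : 1 ≤ q) (hq' : q ≠ ∞) :
    ∃ C : ℝ≥0, ∀ f : HalfSpace n → ℝ, AEMeasurable f (halfSpaceMeasure n) →
      tentNorm δ lam p q f ≤ C * tentNorm α β p q f := by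
  have hp0 : 0 < p.toReal := ENNReal.toReal_pos (zero_lt_one.trans_le hp).ne' hp'
  have hq0 : 0 < q.toReal := ENNReal.toReal_pos (zero_lt_one.trans_le hq).ne' hq'
  obtain ⟨C, hC⟩ := exists_lintegral_coneIntegral_rpow_le n hα hβ hδ hlam (div_pos hp0 hq0)
  refine ⟨max 1 C, fun f hf => ?_⟩
  rw [tentNorm, tentNorm, tentFunctional, tentFunctional, if_neg hp', if_neg hp', if_neg hq',
    if_neg hq']
  refine eLpNorm_le_of_lintegral_rpow_le hp hp' ?_
  have hae : (fun z => ‖f z‖ₑ ^ q.toReal) =ᵐ[halfSpaceMeasure n]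
      fun z => ‖hf.mk f z‖ₑ ^ q.toReal := by
    filter_upwards [hf.ae_eq_mk] with z hz
    rw [← hz]
  simp_rw [areaFun_eq, coneIntegral_congr_ae δ lam hae, coneIntegral_congr_ae α β hae,
    ← ENNReal.rpow_mul, one_div_mul_eq_div]
  exact hC _ (hf.measurable_mk.enorm.pow_const _)

lemma exists_tentNorm_top_right_le (n : ℕ) {α β : ℝ} (hα : 0 < α) (hβ : 0 < β) (δ lam : ℝ) :
    ∃ C : ℝ≥0, ∀ p : ℝ≥0∞, 1 ≤ p → p ≠ ∞ → ∀ f : HalfSpace n → ℝ,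
      tentNorm δ lam p ∞ f ≤ C * tentNorm α β p ∞ f := by
  obtain ⟨C, hC⟩ := exists_gaussian_lt_areaFunTop_le n hα hβ δ lam
  refine ⟨max 1 C, fun p hp hp' f => ?_⟩
  rw [tentNorm, tentNorm, tentFunctional, tentFunctional, if_neg hp', if_neg hp', if_pos rfl,
    if_pos rfl]
  exact eLpNorm_le_of_lintegral_rpow_le hp hp' (lintegral_rpow_le_of_meas_lt_le
    (measurable_areaFunTop _ _ _) (measurable_areaFunTop _ _ _)
    (ENNReal.toReal_pos (zero_lt_one.trans_le hp).ne' hp') fun t => hC f _)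

lemma exists_tentNorm_top_left_le (n : ℕ) {α β δ lam : ℝ} (hα : 0 < α) (hβ : 0 < β)
    (hδ : 0 < δ) (hlam : 0 < lam) :
    ∃ C : ℝ≥0, ∀ q : ℝ≥0∞, 1 ≤ q → q ≠ ∞ → ∀ f : HalfSpace n → ℝ,
      tentNorm α β ∞ q f ≤ C * tentNorm δ lam ∞ q f := by
  obtain ⟨C, hC⟩ := exists_essSup_carlesonFun_le n hα hβ hδ hlam
  refine ⟨C, fun q hq hq' f => ?_⟩
  rw [tentNorm, tentNorm, tentFunctional, tentFunctional, if_pos rfl, if_pos rfl,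
    eLpNorm_exponent_top, eLpNorm_exponent_top, eLpNormEssSup, eLpNormEssSup]
  exact hC q.toReal (by simpa using ENNReal.toReal_mono hq' hq) f

end GaussianTent

end

theorem theorem3p5 (n : ℕ) (hn : 1 ≤ n) (α β δ lam : ℝ)
    (hα : 0 < α) (hβ : 0 < β) (hδ : 0 < δ) (hlam : 0 < lam) :
    -- the case `1 ≤ p, q < ∞`
    (∀ p q : ℝ≥0∞, 1 ≤ p → p < ∞ → 1 ≤ q → q < ∞ →
      (∃ C : ℝ≥0, ∀ f : GaussianTent.HalfSpace n → ℝ,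
        AEMeasurable f (GaussianTent.halfSpaceMeasure n) →
        GaussianTent.tentNorm α β p q f ≤ C * GaussianTent.tentNorm δ lam p q f ∧
        GaussianTent.tentNorm δ lam p q f ≤ C * GaussianTent.tentNorm α β p q f) ∧
      GaussianTent.tentSpace n α β p q = GaussianTent.tentSpace n δ lam p q) ∧
    -- the case `1 < p < ∞`, `q = ∞`
    ((∃ C : ℝ≥0, ∀ p : ℝ≥0∞, 1 < p → p < ∞ →
      ∀ f : GaussianTent.HalfSpace n → ℝ, Continuous f →
        GaussianTent.tentNorm α β p ∞ f ≤ C * GaussianTent.tentNorm δ lam p ∞ f ∧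
        GaussianTent.tentNorm δ lam p ∞ f ≤ C * GaussianTent.tentNorm α β p ∞ f) ∧
      ∀ p : ℝ≥0∞, 1 < p → p < ∞ →
        GaussianTent.tentSpace n α β p ∞ = GaussianTent.tentSpace n δ lam p ∞) ∧
    -- the case `p = ∞`, `1 < q < ∞`
    ((∃ C : ℝ≥0, ∀ q : ℝ≥0∞, 1 < q → q < ∞ →
      ∀ f : GaussianTent.HalfSpace n → ℝ,
        AEMeasurable f (GaussianTent.halfSpaceMeasure n) →
        GaussianTent.tentNorm α β ∞ q f ≤ C * GaussianTent.tentNorm δ lam ∞ q f ∧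
        GaussianTent.tentNorm δ lam ∞ q f ≤ C * GaussianTent.tentNorm α β ∞ q f) ∧
      ∀ q : ℝ≥0∞, 1 < q → q < ∞ →
        GaussianTent.tentSpace n α β ∞ q = GaussianTent.tentSpace n δ lam ∞ q) := by

  have hcoe : ∀ {C D : ℝ≥0} {a b : ℝ≥0∞}, C ≤ D → a ≤ C * b → a ≤ D * b := fun hCD hab =>
    hab.trans (mul_le_mul_left (ENNReal.coe_le_coe.2 hCD) _)
  refine ⟨fun p q hp hp' hq hq' => ?_, ?_, ?_⟩
  · obtain ⟨C, hC⟩ := GaussianTent.exists_tentNorm_le n hδ hlam hα hβ hp hp'.ne hq hq'.ne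
    obtain ⟨D, hD⟩ := GaussianTent.exists_tentNorm_le n hα hβ hδ hlam hp hp'.ne hq hq'.ne
    have h : ∀ f : GaussianTent.HalfSpace n → ℝ,
        AEMeasurable f (GaussianTent.halfSpaceMeasure n) →
        GaussianTent.tentNorm α β p q f ≤ (max C D : ℝ≥0) * GaussianTent.tentNorm δ lam p q f ∧
        GaussianTent.tentNorm δ lam p q f ≤ (max C D : ℝ≥0) * GaussianTent.tentNorm α β p q f :=
      fun f hf => ⟨hcoe (le_max_left _ _) (hC f hf), hcoe (le_max_right _ _) (hD f hf)⟩
    exact ⟨⟨_, h⟩, GaussianTent.tentSpace_eq fun f hf => h f (by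
      rwa [GaussianTent.IsTentAdmissible, if_neg hq'.ne] at hf)⟩
  · obtain ⟨C, hC⟩ := GaussianTent.exists_tentNorm_top_right_le n hδ hlam α β
    obtain ⟨D, hD⟩ := GaussianTent.exists_tentNorm_top_right_le n hα hβ δ lam
    have h : ∀ p : ℝ≥0∞, 1 < p → p < ∞ → ∀ f : GaussianTent.HalfSpace n → ℝ,
        GaussianTent.tentNorm α β p ∞ f ≤ (max C D : ℝ≥0) * GaussianTent.tentNorm δ lam p ∞ f ∧
        GaussianTent.tentNorm δ lam p ∞ f ≤ (max C D : ℝ≥0) * GaussianTent.tentNorm α β p ∞ f :=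
      fun p hp hp' f => ⟨hcoe (le_max_left _ _) (hC p hp.le hp'.ne f),
        hcoe (le_max_right _ _) (hD p hp.le hp'.ne f)⟩
    exact ⟨⟨_, fun p hp hp' f _ => h p hp hp' f⟩,
      fun p hp hp' => GaussianTent.tentSpace_eq fun f _ => h p hp hp' f⟩
  · obtain ⟨C, hC⟩ := GaussianTent.exists_tentNorm_top_left_le n hα hβ hδ hlam
    obtain ⟨D, hD⟩ := GaussianTent.exists_tentNorm_top_left_le n hδ hlam hα hβ
    have h : ∀ q : ℝ≥0∞, 1 < q → q < ∞ → ∀ f : GaussianTent.HalfSpace n → ℝ,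
        GaussianTent.tentNorm α β ∞ q f ≤ (max C D : ℝ≥0) * GaussianTent.tentNorm δ lam ∞ q f ∧
        GaussianTent.tentNorm δ lam ∞ q f ≤ (max C D : ℝ≥0) * GaussianTent.tentNorm α β ∞ q f :=
      fun q hq hq' f => ⟨hcoe (le_max_left _ _) (hC q hq.le hq'.ne f),
        hcoe (le_max_right _ _) (hD q hq.le hq'.ne f)⟩
    exact ⟨⟨_, fun q hq hq' f _ => h q hq hq' f⟩,
      fun q hq hq' => GaussianTent.tentSpace_eq fun f _ => h q hq hq' f⟩
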